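/- Identify $S^1=\mathbb R/\mathbb Z$ and let $\mathrm{Homeo}_+(S^1)$ be the group of homeomorphisms of $S^1$ that lift to increasing homeomorphisms of $\mathbb R$ commuting with $x\mapsto x+1$. For $f\in\mathrm{Homeo}_+(S^1)$ with such a lift $\tilde f$, the rotation number is $\mathrm{rot}(f)=\lim_{n\to\infty}\frac{\tilde f^{\,n}(x)-x}{n}\bmod\mathbb Z\in\mathbb R/\mathbb Z$. Let $\Gamma=\langle\alpha,\beta\mid\alpha^2=\beta^3=1\rangle$ be the modular group, identified with $\mathrm{PSL}(2,\mathbb Z)$ by $\alpha=\left[\begin{smallmatrix}0&-1\\1&0\end{smallmatrix}\right]$, $\beta=\left[\begin{smallmatrix}1&1\\-1&0\end{smallmatrix}\right]$. A homomorphism $\phi_1:\Gamma\to\mathrm{Homeo}_+(S^1)$ is semi-conjugate to $\phi_2:\Gamma\to\mathrm{Homeo}_+(S^1)$ if there is a map $h:S^1\to S^1$ having a continuous nondecreasing lift $\tilde h:\mathbb R\to\mathbb R$ that commutes with $x\mapsto x+1$, such that $h\circ\phi_1(\gamma)=\phi_2(\gamma)\circ h$ for all $\gamma\in\Gamma$.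 The semi-conjugacy class of $\phi$ is its class under the equivalence relation generated by semi-conjugacy. A $k$-fold lift of $\psi:\Gamma\to\mathrm{Homeo}_+(S^1)$ is a homomorphism $\phi:\Gamma\to\mathrm{Homeo}_+(S^1)$ with $k\cdot\phi(\gamma)(x)=\psi(\gamma)(k\cdot x)$ for all $\gamma\in\Gamma$, $x\in S^1$. Let $\phi_0:\Gamma\to\mathrm{Homeo}_+(S^1)$ be the standard Fuchsian action, i.e. the action of $\mathrm{PSL}(2,\mathbb Z)$ by linear fractional transformations on $\mathbb R\cup\{\infty\}$, where $\mathbb R\cup\{\infty\}$ is identified with $S^1$ by $\theta\mapsto\tan(\pi\theta)$. **Theorem 1.1.** Let $\phi:\Gamma\to\mathrm{Homeo}_+(S^1)$ be a homomorphism. 1. If $(\mathrm{rot}(\phi(\alpha)),\mathrm{rot}(\phi(\beta)),\mathrm{rot}(\phi(\alpha\beta)))=\left(\frac12,\frac13,0\right)$ in $(\mathbb R/\mathbb Z)^3$, then $\phi$ belongs to the semi-conjugacy class of $\phi_0$. 2. The action $\phi_0$ has exactly one $5$-fold lift $\phi_0^{(5)}$, and if $(\mathrm{rot}(\phi(\alpha)),\mathrm{rot}(\phi(\beta)),\mathrm{rot}(\phi(\alpha\beta)))=\left(\frac12,\frac23,\frac15\right)$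 in $(\mathbb R/\mathbb Z)^3$, then $\phi$ belongs to the semi-conjugacy class of $\phi_0^{(5)}$. -/

import Mathlib

open scoped MatrixGroups

noncomputable section

namespace ModularCircle

/-- The group of lifts to `ℝ` of orientation-preserving circle homeomorphisms is
`CircleDeg1Liftˣ`: the increasing bijections of `ℝ` that commute with `x ↦ x + 1`.
`HomeoPlus` is the group of orientation-preserving homeomorphisms of the circle `ℝ / ℤ`:
those homeomorphisms that admit such a lift. -/
def HomeoPlus : Subgroup (UnitAddCircle ≃ₜ UnitAddCircle) where
  carrier := {f | ∃ F : CircleDeg1Liftˣ, ∀ x : ℝ, f (x : UnitAddCircle) = 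
    ((F x : ℝ) : UnitAddCircle)}
  one_mem' := ⟨1, fun _ => rfl⟩
  mul_mem' := by
    rintro f g ⟨F, hF⟩ ⟨G, hG⟩
    refine ⟨F * G, fun x => ?_⟩
    rw [Homeomorph.mul_apply, hG, hF]
    rfl
  inv_mem' := by
    rintro f ⟨F, hF⟩
    refine ⟨F⁻¹, fun x => ?_⟩
    apply f.injective
    rw [hF, CircleDeg1Lift.units_apply_inv_apply]
    exact f.apply_symm_apply _

/-- The rotation number in `ℝ / ℤ`: the translation number of a lift, modulo `ℤ`. -/
def rot (f : HomeoPlus) : UnitAddCircle :=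
  ((CircleDeg1Lift.translationNumber (f.2.choose : CircleDeg1Lift) : ℝ) : UnitAddCircle)

theorem coe_int_eq_zero (n : ℤ) : ((n : ℝ) : UnitAddCircle) = 0 := by
  rw [AddCircle.coe_eq_zero_iff]
  exact ⟨n, by simp⟩

theorem coe_eq_coe (x y : ℝ) :
    (x : UnitAddCircle) = (y : UnitAddCircle) ↔ ∃ n : ℤ, x = y + n := by
  rw [← sub_eq_zero, ← AddCircle.coe_sub, AddCircle.coe_eq_zero_iff]
  constructor
  · rintro ⟨n, hn⟩
    refine ⟨n, ?_⟩
    simp at hn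
    linarith
  · rintro ⟨n, hn⟩
    refine ⟨n, ?_⟩
    simp
    linarith

/-- Two lifts of the same circle map differ by an integer translation. -/
theorem lift_unique (F G : CircleDeg1Liftˣ)
    (h : ∀ x : ℝ, ((F x : ℝ) : UnitAddCircle) = ((G x : ℝ) : UnitAddCircle)) :
    ∃ n : ℤ, ∀ x : ℝ, F x = G x + n := by
  have hF : Continuous (F : CircleDeg1Lift) := by
    rw [CircleDeg1Lift.continuous_iff_surjective]
    exact (CircleDeg1Lift.toOrderIso F).surjective
  have hG : Continuous (G : CircleDeg1Lift) := by
    rw [CircleDeg1Lift.continuous_iff_surjective]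
    exact (CircleDeg1Lift.toOrderIso G).surjective
  choose n hn using fun x => (coe_eq_coe _ _).1 (h x)
  have hc : Continuous fun x => ((n x : ℤ) : ℝ) := by
    have : (fun x => ((n x : ℤ) : ℝ)) = fun x => F x - G x := by
      funext x
      rw [hn x]
      ring
    rw [this]
    exact hF.sub hG
  have hn' : Continuous n := Int.isClosedEmbedding_coe_real.isEmbedding.continuous_iff.2 hc
  refine ⟨n 0, fun x => ?_⟩
  rw [hn x, PreconnectedSpace.constant inferInstance hn']

/-- The rotation number can be computed with any lift. -/
theorem rot_eq (f : HomeoPlus) (F : CircleDeg1Liftˣ)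
    (hF : ∀ x : ℝ, f.1 (x : UnitAddCircle) = ((F x : ℝ) : UnitAddCircle)) :
    rot f = ((CircleDeg1Lift.translationNumber (F : CircleDeg1Lift) : ℝ) : UnitAddCircle) := by
  obtain ⟨n, hn⟩ := lift_unique f.2.choose F fun x => by
    rw [← hF, ← f.2.choose_spec]
  have h : (f.2.choose : CircleDeg1Lift) =
      (CircleDeg1Lift.translate (Multiplicative.ofAdd (n : ℝ)) : CircleDeg1Lift) * F := by
    ext x
    rw [hn x, CircleDeg1Lift.mul_apply, CircleDeg1Lift.translate_apply, add_comm]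
  have hc : Commute (CircleDeg1Lift.translate (Multiplicative.ofAdd (n : ℝ)) : CircleDeg1Lift)
      (F : CircleDeg1Lift) := by
    ext x
    simp [CircleDeg1Lift.mul_apply]
  rw [rot, h, CircleDeg1Lift.translationNumber_mul_of_commute hc,
    CircleDeg1Lift.translationNumber_translate, AddCircle.coe_add, coe_int_eq_zero, zero_add]

/-- `φ₁` is semi-conjugate to `φ₂` through a continuous degree-one monotone map `h` of the circle,
i.e. a map with a continuous nondecreasing lift `H` commuting with `x ↦ x + 1`. -/
def SemiConjugate {Γ : Type*} [Group Γ] (φ₁ φ₂ : Γ →* HomeoPlus) : Prop :=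
  ∃ (h : UnitAddCircle → UnitAddCircle) (H : CircleDeg1Lift), Continuous H ∧
    (∀ x : ℝ, h (x : UnitAddCircle) = ((H x : ℝ) : UnitAddCircle)) ∧
    ∀ (γ : Γ) (x : UnitAddCircle), h ((φ₁ γ).1 x) = (φ₂ γ).1 (h x)

/-- Two actions are in the same semi-conjugacy class (monotone equivalence class) if they are
related by the equivalence relation generated by semi-conjugacy. -/
def SameSemiConjugacyClass {Γ : Type*} [Group Γ] (φ₁ φ₂ : Γ →* HomeoPlus) : Prop :=
  Relation.EqvGen SemiConjugate φ₁ φ₂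

/-- `φ` is a `k`-fold lift of `ψ`; the `k`-fold covering of `ℝ / ℤ` is `x ↦ k • x`. -/
def IsFoldLift {Γ : Type*} [Group Γ] (k : ℕ) (φ ψ : Γ →* HomeoPlus) : Prop :=
  ∀ (γ : Γ) (x : UnitAddCircle), k • ((φ γ).1 x) = (ψ γ).1 (k • x)

/-- The relators `α²` and `β³`, where `α`, `β` are the free generators number `0`, `1`. -/
def modularRels : Set (FreeGroup (Fin 2)) :=
  {FreeGroup.of 0 ^ 2, FreeGroup.of 1 ^ 3}

/-- The modular group `⟨α, β | α² = β³ = 1⟩`. -/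
abbrev Gam : Type := PresentedGroup modularRels

def α : Gam := PresentedGroup.of 0

def β : Gam := PresentedGroup.of 1

/-- The matrix `[0, -1; 1, 0]`. -/
def matA : SL(2, ℤ) := ⟨!![0, -1; 1, 0], by simp [Matrix.det_fin_two]⟩

/-- The matrix `[1, 1; -1, 0]`. -/
def matB : SL(2, ℤ) := ⟨!![1, 1; -1, 0], by simp [Matrix.det_fin_two]⟩

/-- The identification of the modular group with `PSL(2, ℤ)`. -/
def toPSL : Gam →* PSL(2, ℤ) :=
  PresentedGroup.toGroup (f := ![(QuotientGroup.mk matA : PSL(2, ℤ)), QuotientGroup.mk matB]) (by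
    have hA : matA ^ 2 ∈ Subgroup.center SL(2, ℤ) := by
      rw [Matrix.SpecialLinearGroup.mem_center_iff]
      refine ⟨-1, by simp, ?_⟩
      decide
    have hB : matB ^ 3 ∈ Subgroup.center SL(2, ℤ) := by
      rw [Matrix.SpecialLinearGroup.mem_center_iff]
      refine ⟨-1, by simp, ?_⟩
      decide
    rintro r (rfl | rfl)
    · simp only [map_pow, FreeGroup.lift_apply_of, Matrix.cons_val_zero]
      exact (QuotientGroup.eq_one_iff _).2 hA
    · simp only [map_pow, FreeGroup.lift_apply_of, Matrix.cons_val_one]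
      exact (QuotientGroup.eq_one_iff _).2 hB)

/-! ### The action of `SL(2, ℝ)` on `ℝ ∪ {∞}` seen as the circle `ℝ / ℤ` -/

/-- The point of `ℝ ∪ {∞}` with parameter `θ`: `tan (π θ)`, which is `∞` for `θ ∈ 1/2 + ℤ`. -/
def linePoint (θ : ℝ) : OnePoint ℝ :=
  open Classical in
  if Real.cos (Real.pi * θ) = 0 then OnePoint.infty
  else ((Real.tan (Real.pi * θ) : ℝ) : OnePoint ℝ)

theorem sincos_ne (θ : ℝ) : ![Real.sin (Real.pi * θ), Real.cos (Real.pi * θ)] ≠ 0 := by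
  intro h
  have h0 := congrFun h 0
  have h1 := congrFun h 1
  simp at h0 h1
  have := Real.sin_sq_add_cos_sq (Real.pi * θ)
  rw [h0, h1] at this
  norm_num at this

theorem linePoint_proj (θ : ℝ) : linePoint θ = (OnePoint.equivProjectivization ℝ).symm
    (Projectivization.mk ℝ ![Real.sin (Real.pi * θ), Real.cos (Real.pi * θ)] (sincos_ne θ)) := by
  rw [OnePoint.equivProjectivization_symm_apply_mk, linePoint]
  simp [Real.tan_eq_sin_div_cos, div_eq_inv_mul]

theorem linePoint_add_one (θ : ℝ) : linePoint (θ + 1) = linePoint θ := by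
  unfold linePoint
  rw [mul_add, mul_one, Real.cos_add_pi, Real.tan_add_pi]
  simp

theorem linePoint_eq_iff (x y : ℝ) :
    linePoint x = linePoint y ↔ (x : UnitAddCircle) = (y : UnitAddCircle) := by
  have key : linePoint x = linePoint y ↔ Real.sin (Real.pi * (x - y)) = 0 := by
    rw [linePoint_proj, linePoint_proj, (OnePoint.equivProjectivization ℝ).symm.injective.eq_iff,
      mul_sub, Real.sin_sub, Projectivization.mk_eq_mk_iff']
    have hx := Real.sin_sq_add_cos_sq (Real.pi * x)
    have hy := Real.sin_sq_add_cos_sq (Real.pi * y)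
    constructor
    · rintro ⟨a, ha⟩
      have h0 := congrFun ha 0
      have h1 := congrFun ha 1
      simp at h0 h1
      rw [← h0, ← h1]
      ring
    · intro h
      refine ⟨Real.cos (Real.pi * x) * Real.cos (Real.pi * y) +
        Real.sin (Real.pi * x) * Real.sin (Real.pi * y), ?_⟩
      ext i
      fin_cases i
      · simp
        linear_combination Real.sin (Real.pi * x) * hy - Real.cos (Real.pi * y) * h
      · simp
        linear_combination Real.cos (Real.pi * x) * hy + Real.sin (Real.pi * y) * h
  rw [key, Real.sin_eq_zero_iff, coe_eq_coe]
  refine exists_congr fun n => ?_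
  rw [mul_comm, mul_right_inj' Real.pi_ne_zero]
  constructor <;> intro h <;> linarith

theorem linePoint_surjective : Function.Surjective linePoint := by
  intro p
  induction p using OnePoint.rec with
  | infty => exact ⟨1 / 2, by
    have : Real.pi * (1 / 2) = Real.pi / 2 := by ring
    rw [linePoint, this, Real.cos_pi_div_two, if_pos rfl]⟩
  | coe t =>
    refine ⟨Real.arctan t / Real.pi, ?_⟩
    have : Real.pi * (Real.arctan t / Real.pi) = Real.arctan t := by field_simp
    rw [linePoint, this, if_neg (Real.cos_arctan_pos t).ne', Real.tan_arctan]

/-- The identification `ℝ / ℤ ≃ ℝ ∪ {∞}`, `θ ↦ tan (π θ)`, increasing on `(-1/2, 1/2)`. -/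
def circleToLine : UnitAddCircle ≃ OnePoint ℝ :=
  Equiv.ofBijective
    (Function.Periodic.lift (f := linePoint) (c := 1) linePoint_add_one) (by
      constructor
      · intro a b
        induction a using QuotientAddGroup.induction_on
        induction b using QuotientAddGroup.induction_on
        exact (linePoint_eq_iff _ _).1
      · intro p
        obtain ⟨t, rfl⟩ := linePoint_surjective p
        exact ⟨(t : UnitAddCircle), rfl⟩)

theorem circleToLine_coe (θ : ℝ) : circleToLine (θ : UnitAddCircle) = linePoint θ := rfl

/-- A linear fractional transformation of `ℝ ∪ {∞}` lifts to an increasing bijection of `ℝ`. -/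
theorem exists_lift (g : SL(2, ℝ)) : ∃ F : CircleDeg1Liftˣ, ∀ θ : ℝ,
    linePoint (F θ) = Matrix.SpecialLinearGroup.toGL g • linePoint θ := by
  have hdet : g 0 0 * g 1 1 - g 0 1 * g 1 0 = 1 := by
    rw [← Matrix.det_fin_two]
    exact g.2
  set a : ℂ := ⟨(g 1 1 + g 0 0) / 2, (g 0 1 - g 1 0) / 2⟩ with ha
  set b : ℂ := ⟨(g 1 1 - g 0 0) / 2, (g 0 1 + g 1 0) / 2⟩ with hb
  -- the real-linear map given by `g` is `ζ ↦ a ζ + b (conj ζ)`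
  let E : ℝ → ℂ := fun θ => ⟨Real.cos (2 * (Real.pi * θ)), -Real.sin (2 * (Real.pi * θ))⟩
  let c : ℝ → ℂ := fun θ => (starRingEnd ℂ) a * (a + b * E θ)
  have hE : Continuous E := by
    have : E = fun θ => ((Real.cos (2 * (Real.pi * θ)) : ℝ) : ℂ) +
        ((-Real.sin (2 * (Real.pi * θ)) : ℝ) : ℂ) * Complex.I := by
      funext θ
      exact (Complex.re_add_im (E θ)).symm
    rw [this]
    fun_prop
  have hc : Continuous c := by fun_prop
  have hab : a.re ^ 2 + a.im ^ 2 = b.re ^ 2 + b.im ^ 2 + 1 := by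
    simp only [ha, hb]
    linear_combination hdet
  have hcs : ∀ θ, c θ ∈ Complex.slitPlane := by
    intro θ
    left
    have h2 := Real.sin_sq_add_cos_sq (2 * (Real.pi * θ))
    have hre : (c θ).re = a.re ^ 2 + a.im ^ 2 +
        ((a.re * b.re + a.im * b.im) * Real.cos (2 * (Real.pi * θ)) +
        (a.re * b.im - a.im * b.re) * Real.sin (2 * (Real.pi * θ))) := by
      simp only [c, E, Complex.mul_re, Complex.mul_im, Complex.add_re, Complex.add_im,
        Complex.conj_re, Complex.conj_im]
      ring
    rw [hre]
    by_contra hneg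
    push Not at hneg
    set X := (a.re * b.re + a.im * b.im) * Real.cos (2 * (Real.pi * θ)) +
      (a.re * b.im - a.im * b.re) * Real.sin (2 * (Real.pi * θ)) with hX
    have hX2 : X ^ 2 ≤ (a.re ^ 2 + a.im ^ 2) * (b.re ^ 2 + b.im ^ 2) := by
      have h3 : X ^ 2 + ((a.re * b.re + a.im * b.im) * Real.sin (2 * (Real.pi * θ)) -
          (a.re * b.im - a.im * b.re) * Real.cos (2 * (Real.pi * θ))) ^ 2 =
          (a.re ^ 2 + a.im ^ 2) * (b.re ^ 2 + b.im ^ 2) := by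
        rw [hX]
        linear_combination ((a.re ^ 2 + a.im ^ 2) * (b.re ^ 2 + b.im ^ 2)) * h2
      linarith [sq_nonneg ((a.re * b.re + a.im * b.im) * Real.sin (2 * (Real.pi * θ)) -
          (a.re * b.im - a.im * b.re) * Real.cos (2 * (Real.pi * θ)))]
    have hB : 0 ≤ b.re ^ 2 + b.im ^ 2 := by positivity
    nlinarith
  have ha0 : a ≠ 0 := by
    intro h
    rw [h] at hab
    simp at hab
    nlinarith [sq_nonneg b.re, sq_nonneg b.im]
  let F₀ : ℝ → ℝ := fun θ => θ + (a.arg + (c θ).arg) / Real.pi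
  have hF₀ : Continuous F₀ := by
    have : Continuous fun θ => (c θ).arg :=
      continuous_iff_continuousAt.2 fun θ =>
        (Complex.continuousAt_arg (hcs θ)).comp hc.continuousAt
    fun_prop
  have hF₁ : ∀ θ, F₀ (θ + 1) = F₀ θ + 1 := by
    intro θ
    have : E (θ + 1) = E θ := by
      have h : 2 * (Real.pi * (θ + 1)) = 2 * (Real.pi * θ) + 2 * Real.pi := by ring
      simp only [E, h, Real.cos_add_two_pi, Real.sin_add_two_pi]
    simp only [F₀, c, this]
    ring
  have hline : ∀ θ, linePoint (F₀ θ) = Matrix.SpecialLinearGroup.toGL g • linePoint θ := by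
    intro θ
    have hc0 : c θ ≠ 0 := Complex.slitPlane_ne_zero (hcs θ)
    have hpi : Real.pi * F₀ θ = Real.pi * θ + (a.arg + (c θ).arg) := by
      simp only [F₀]
      field_simp
    have a1 := Complex.norm_mul_cos_arg a
    have a2 := Complex.norm_mul_sin_arg a
    have c1 := Complex.norm_mul_cos_arg (c θ)
    have c2 := Complex.norm_mul_sin_arg (c θ)
    have h2 := Real.sin_sq_add_cos_sq (Real.pi * θ)
    have hcr : (c θ).re = a.re ^ 2 + a.im ^ 2 +
        ((a.re * b.re + a.im * b.im) * (2 * Real.cos (Real.pi * θ) ^ 2 - 1) +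
        (a.re * b.im - a.im * b.re) *
          (2 * Real.sin (Real.pi * θ) * Real.cos (Real.pi * θ))) := by
      simp only [c, E, Complex.mul_re, Complex.mul_im, Complex.add_re, Complex.add_im,
        Complex.conj_re, Complex.conj_im, Real.cos_two_mul, Real.sin_two_mul]
      ring
    have hci : (c θ).im =
        ((a.re * b.im - a.im * b.re) * (2 * Real.cos (Real.pi * θ) ^ 2 - 1) -
        (a.re * b.re + a.im * b.im) *
          (2 * Real.sin (Real.pi * θ) * Real.cos (Real.pi * θ))) := by
      simp only [c, E, Complex.mul_re, Complex.mul_im, Complex.add_re, Complex.add_im,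
        Complex.conj_re, Complex.conj_im, Real.cos_two_mul, Real.sin_two_mul]
      ring
    have hN : 0 < a.re ^ 2 + a.im ^ 2 := by
      rw [hab]
      positivity
    have hcos : ‖a‖ * ‖c θ‖ * Real.cos (Real.pi * F₀ θ) = (a.re ^ 2 + a.im ^ 2) *
        (g 1 0 * Real.sin (Real.pi * θ) + g 1 1 * Real.cos (Real.pi * θ)) := by
      have e1 : ‖a‖ * ‖c θ‖ * Real.cos (Real.pi * F₀ θ) =
          Real.cos (Real.pi * θ) * (a.re * (c θ).re - a.im * (c θ).im) -
          Real.sin (Real.pi * θ) * (a.im * (c θ).re + a.re * (c θ).im) := by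
        rw [hpi, Real.cos_add, Real.cos_add, Real.sin_add, ← a1, ← a2, ← c1, ← c2]
        ring
      have e2 : g 1 0 = b.im - a.im := by simp only [ha, hb]; ring
      have e3 : g 1 1 = a.re + b.re := by simp only [ha, hb]; ring
      rw [e1, hcr, hci, e2, e3]
      set C := Real.cos (Real.pi * θ)
      set S := Real.sin (Real.pi * θ)
      linear_combination (2 * C * (a.re ^ 2 + a.im ^ 2) * b.re) * h2
    have hsin : ‖a‖ * ‖c θ‖ * Real.sin (Real.pi * F₀ θ) = (a.re ^ 2 + a.im ^ 2) *
        (g 0 0 * Real.sin (Real.pi * θ) + g 0 1 * Real.cos (Real.pi * θ)) := by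
      have e1 : ‖a‖ * ‖c θ‖ * Real.sin (Real.pi * F₀ θ) =
          Real.sin (Real.pi * θ) * (a.re * (c θ).re - a.im * (c θ).im) +
          Real.cos (Real.pi * θ) * (a.im * (c θ).re + a.re * (c θ).im) := by
        rw [hpi, Real.sin_add, Real.cos_add, Real.sin_add, ← a1, ← a2, ← c1, ← c2]
        ring
      have e2 : g 0 0 = a.re - b.re := by simp only [ha, hb]; ring
      have e3 : g 0 1 = a.im + b.im := by simp only [ha, hb]; ring
      rw [e1, hcr, hci, e2, e3]
      set C := Real.cos (Real.pi * θ)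
      set S := Real.sin (Real.pi * θ)
      linear_combination (2 * C * (a.re ^ 2 + a.im ^ 2) * b.im) * h2
    rw [← (OnePoint.equivProjectivization ℝ).injective.eq_iff, OnePoint.equivProjectivization_smul,
      linePoint_proj, linePoint_proj, Equiv.apply_symm_apply, Equiv.apply_symm_apply,
      Projectivization.smul_mk, Projectivization.mk_eq_mk_iff']
    have hn : ‖a‖ * ‖c θ‖ ≠ 0 := mul_ne_zero (norm_ne_zero_iff.2 ha0) (norm_ne_zero_iff.2 hc0)
    refine ⟨(a.re ^ 2 + a.im ^ 2) / (‖a‖ * ‖c θ‖), ?_⟩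
    ext i
    fin_cases i
    · simp [Matrix.mulVec_eq_sum, Units.smul_def]
      field_simp
      linear_combination -hsin
    · simp [Matrix.mulVec_eq_sum, Units.smul_def]
      field_simp
      linear_combination -hcos
  have hinj : Function.Injective F₀ := by
    intro x y hxy
    have h1 : linePoint x = linePoint y := by
      have := hline x
      rw [hxy, hline y] at this
      exact ((MulAction.injective _) this).symm
    obtain ⟨n, rfl⟩ := (coe_eq_coe _ _).1 ((linePoint_eq_iff _ _).1 h1)
    have hn : ∀ n : ℕ, ∀ x, F₀ (x + n) = F₀ x + n := by
      intro n
      induction n with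
      | zero => simp
      | succ k ih =>
        intro x
        push_cast
        rw [← add_assoc, hF₁, ih, add_assoc]
    rcases n with n | n
    · have := hn n y
      simp at hxy ⊢
      rw [hxy] at this
      exact_mod_cast (by linarith : (n : ℝ) = 0)
    · exfalso
      have := hn (n + 1) (y + (Int.negSucc n : ℤ))
      rw [hxy] at this
      push_cast [Int.cast_negSucc] at this
      rw [neg_add_cancel_right] at this
      have h0 : (0 : ℝ) ≤ n := n.cast_nonneg
      linarith
  have hmono : StrictMono F₀ := by
    rcases hF₀.strictMono_of_inj hinj with h | h
    · exact h
    · have h1 := h (zero_lt_one (α := ℝ))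
      have h2 := hF₁ 0
      rw [zero_add] at h2
      linarith
  let F₂ : CircleDeg1Lift := ⟨⟨F₀, hmono.monotone⟩, hF₁⟩
  have hu : IsUnit F₂ := CircleDeg1Lift.isUnit_iff_bijective.2
    ⟨hinj, F₂.continuous_iff_surjective.1 hF₀⟩
  obtain ⟨u, hu⟩ := hu
  refine ⟨u, fun θ => ?_⟩
  rw [hu]
  exact hline θ

theorem conj_coe (g : SL(2, ℝ)) : ∃ F : CircleDeg1Liftˣ, ∀ θ : ℝ,
    circleToLine.symm (Matrix.SpecialLinearGroup.toGL g • circleToLine (θ : UnitAddCircle)) =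
      ((F θ : ℝ) : UnitAddCircle) := by
  obtain ⟨F, hF⟩ := exists_lift g
  refine ⟨F, fun θ => ?_⟩
  rw [Equiv.symm_apply_eq, circleToLine_coe, circleToLine_coe, hF]

theorem conj_continuous (g : SL(2, ℝ)) : Continuous fun x : UnitAddCircle =>
    circleToLine.symm (Matrix.SpecialLinearGroup.toGL g • circleToLine x) := by
  obtain ⟨F, hF⟩ := conj_coe g
  have hc : Continuous (F : CircleDeg1Lift) := by
    rw [CircleDeg1Lift.continuous_iff_surjective]
    exact (CircleDeg1Lift.toOrderIso F).surjective
  refine (QuotientAddGroup.isQuotientMap_mk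
    (N := AddSubgroup.zmultiples (1 : ℝ))).continuous_iff.2 ?_
  refine ((AddCircle.continuous_mk' (1 : ℝ)).comp hc).congr fun θ => ?_
  exact (hF θ).symm

/-- The circle homeomorphism corresponding to the linear fractional transformation `g`. -/
def moebiusHomeo (g : SL(2, ℝ)) : UnitAddCircle ≃ₜ UnitAddCircle where
  toFun x := circleToLine.symm (Matrix.SpecialLinearGroup.toGL g • circleToLine x)
  invFun x := circleToLine.symm (Matrix.SpecialLinearGroup.toGL g⁻¹ • circleToLine x)
  left_inv x := by simp
  right_inv x := by simp
  continuous_toFun := conj_continuous g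
  continuous_invFun := conj_continuous g⁻¹

/-- The action of `SL(2, ℝ)` on the circle by linear fractional transformations. -/
def moebius : SL(2, ℝ) →* HomeoPlus where
  toFun g := ⟨moebiusHomeo g, conj_coe g⟩
  map_one' := by
    ext x
    simp [moebiusHomeo]
  map_mul' g h := by
    ext x
    simp [moebiusHomeo, mul_smul]

/-- The action of `PSL(2, ℤ)` on the circle by linear fractional transformations. -/
def moebiusPSL : PSL(2, ℤ) →* HomeoPlus :=
  QuotientGroup.lift _ (moebius.comp (Matrix.SpecialLinearGroup.map (Int.castRingHom ℝ))) (by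
    intro z hz
    obtain ⟨r, hr, hz⟩ := Matrix.SpecialLinearGroup.mem_center_iff.1 hz
    have hr0 : (r : ℝ) ≠ 0 := by
      rintro h
      rw [Int.cast_eq_zero.1 h] at hr
      simp at hr
    have h00 : z 0 0 = r := by rw [← hz, Matrix.scalar_apply]; simp
    have h01 : z 0 1 = 0 := by rw [← hz, Matrix.scalar_apply]; simp
    have h10 : z 1 0 = 0 := by rw [← hz, Matrix.scalar_apply]; simp
    have h11 : z 1 1 = r := by rw [← hz, Matrix.scalar_apply]; simp
    rw [MonoidHom.mem_ker]
    ext x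
    change circleToLine.symm _ = x
    rw [Equiv.symm_apply_eq]
    induction circleToLine x using OnePoint.rec with
    | infty => simp [OnePoint.smul_infty_eq_ite, h10]
    | coe t => simp [OnePoint.smul_some_eq_ite, h00, h01, h10, h11, hr0])

/-- The standard Fuchsian action of the modular group, by linear fractional transformations on
`ℝ ∪ {∞}`, the latter identified with the circle. -/
def fuchsian : Gam →* HomeoPlus := moebiusPSL.comp toPSL

/-- Under the identification with `ℝ ∪ {∞}`, `α` acts by its matrix. -/
theorem fuchsian_α (x : UnitAddCircle) : circleToLine ((fuchsian α).1 x) =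
    Matrix.SpecialLinearGroup.toGL
      (Matrix.SpecialLinearGroup.map (Int.castRingHom ℝ) matA) • circleToLine x := by
  have h : toPSL α = (QuotientGroup.mk matA : PSL(2, ℤ)) := PresentedGroup.toGroup.of _
  rw [fuchsian, MonoidHom.comp_apply, h]
  exact circleToLine.apply_symm_apply _

/-- Under the identification with `ℝ ∪ {∞}`, `β` acts by its matrix. -/
theorem fuchsian_β (x : UnitAddCircle) : circleToLine ((fuchsian β).1 x) =
    Matrix.SpecialLinearGroup.toGL
      (Matrix.SpecialLinearGroup.map (Int.castRingHom ℝ) matB) • circleToLine x := by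
  have h : toPSL β = (QuotientGroup.mk matB : PSL(2, ℤ)) := PresentedGroup.toGroup.of _
  rw [fuchsian, MonoidHom.comp_apply, h]
  exact circleToLine.apply_symm_apply _

end ModularCircle

end

/-!
The two parts have the same proof. An action of the modular group with the given rotation numbers
has generators with lifts `A`, `B` to the line satisfying `A² = T` and `B³ = T ^ m`, where `T` is
the unit translation and `m` is `1` or `2`. The rotation number of `α β` takes its extreme value,
and this forces a rigid combinatorial pattern: in the first part `A` and `B` agree at some point
(`exists_map_eq_map`); in the second part `(A B)⁵` moves some point `x` by exactly `6`
(`exists_pow_five_eq`), and the relations determine how the five translates of `x` in its orbit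
interlace with their images under `B` (`IsFiveOrbit.q_lt`, `IsFiveOrbit.lt_q`). In both cases these
points cut the line into intervals on which `A` and `B` play ping-pong (`IsPingPong`).

If two actions have ping-pong partitions of the same type, then a reduced word moves the base
points of both partitions into intervals with the same index (`Itinerary`), so that the two orbits
stay within bounded distance of each other. Hence corresponding words have equal translation
numbers, and by a theorem of Ghys in Mathlib's form there is a monotone equivariant map from the
first action to the second (`exists_semiconj`).

This is applied with the Fuchsian action, or its five-fold lift, as the second action. Equivariance
forces the map to take the base point to a point over the fixed point `0` of the parabolic element
`α⁻¹ β`, so its range contains all points over the orbit of this cusp, that is, over the rational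
points of `ℝ ∪ {∞}`. These are dense, and a monotone map with dense range is continuous
(`continuous_of_fibre_subset`); it is therefore a semi-conjugacy. The five-fold lift is constructed
and shown to be unique by solving two congruences modulo `5` for the lifts of the generators
(`exists_five_fold_lift`).
-/

noncomputable section

namespace ModularCircle

open CircleDeg1Lift

/-! ### Cyclic partitions and itineraries -/

/-- A ping-pong partition of the line for a pair `A`, `B` of lifts. The points
`… ≤ p n ≤ q n ≤ p (n + 1) ≤ …`, where the unit translation moves `p n` to `p (n + k)`, cut the
line into intervals `I n = [p n, q n]` and `J n = [q n, p (n + 1)]`. The conditions say that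
`A (J n) ⊆ I (n + a + 1)`, `B (I n) ⊆ J (n + b)` and `B (B (I n)) ⊆ J (n + 2 b)`. -/
structure IsPingPong (A B : CircleDeg1Lift) (k a b : ℤ) (p q : ℤ → ℝ) : Prop where
  le : ∀ n, p n ≤ q n
  le' : ∀ n, q n ≤ p (n + 1)
  p_add : ∀ n, p (n + k) = p n + 1
  A_q : ∀ n, p (n + a + 1) ≤ A (q n)
  A_p : ∀ n, A (p (n + 1)) ≤ q (n + a + 1)
  B_p : ∀ n, q (n + b) ≤ B (p n)
  B_q : ∀ n, B (q n) ≤ p (n + b + 1)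
  BB_p : ∀ n, q (n + 2 * b) ≤ B (B (p n))
  BB_q : ∀ n, B (B (q n)) ≤ p (n + 2 * b + 1)

/-- Pairs of points reached from `(x, x')` by applying one and the same reduced word to both
coordinates, together with a label predicting where they lie in ping-pong partitions of both
actions: `(false, n)` stands for the interval `I n` and `(true, n)` for `J n`. -/
inductive Itinerary (A B A' B' : CircleDeg1Lift) (k a b : ℤ) (x x' : ℝ) :
    Bool → ℤ → ℝ → ℝ → Prop
  | left (j : ℤ) : Itinerary A B A' B' k a b x x' false (k * j) (x + j) (x' + j)
  | right (j : ℤ) : Itinerary A B A' B' k a b x x' true (k * j - 1) (x + j) (x' + j)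
  | stepA {n : ℤ} {y y' : ℝ} : Itinerary A B A' B' k a b x x' true n y y' →
      Itinerary A B A' B' k a b x x' false (n + a + 1) (A y) (A' y')
  | stepB {n : ℤ} {y y' : ℝ} : Itinerary A B A' B' k a b x x' false n y y' →
      Itinerary A B A' B' k a b x x' true (n + b) (B y) (B' y')
  | stepBB {n : ℤ} {y y' : ℝ} : Itinerary A B A' B' k a b x x' false n y y' →
      Itinerary A B A' B' k a b x x' true (n + 2 * b) (B (B y)) (B' (B' y'))

theorem IsPingPong.p_add_mul {A B : CircleDeg1Lift} {k a b : ℤ} {p q : ℤ → ℝ}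
    (h : IsPingPong A B k a b p q) (n j : ℤ) : p (n + k * j) = p n + j := by
  induction j using Int.induction_on with
  | zero => simp
  | succ i ih =>
    rw [mul_add, mul_one, ← add_assoc, h.p_add, ih]
    push_cast
    ring
  | pred i ih =>
    have := h.p_add (n + k * (-i - 1))
    rw [show n + k * (-i - 1) + k = n + k * -i by ring, ih] at this
    push_cast at this ⊢
    linarith

namespace Itinerary

variable {A B A' B' : CircleDeg1Lift} {k a b : ℤ} {x x' : ℝ}

theorem swap {s : Bool} {n : ℤ} {y y' : ℝ} (h : Itinerary A B A' B' k a b x x' s n y y') :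
    Itinerary A' B' A B k a b x' x s n y' y := by
  induction h with
  | left j => exact left j
  | right j => exact right j
  | stepA _ ih => exact stepA ih
  | stepB _ ih => exact stepB ih
  | stepBB _ ih => exact stepBB ih

theorem mem_Icc {p q : ℤ → ℝ} (h : IsPingPong A B k a b p q) {s : Bool} {n : ℤ} {y y' : ℝ}
    (hy : Itinerary A B A' B' k a b (p 0) x' s n y y') :
    y ∈ if s then Set.Icc (q n) (p (n + 1)) else Set.Icc (p n) (q n) := by
  induction hy with
  | left j =>
    have h0 := h.p_add_mul 0 j
    rw [zero_add] at h0
    exact ⟨h0.le, h0.symm.le.trans (h.le _)⟩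
  | right j =>
    have h0 := h.p_add_mul 0 j
    rw [zero_add] at h0
    have h1 := h.le' (k * j - 1)
    rw [if_pos rfl, sub_add_cancel, ← h0]
    rw [sub_add_cancel] at h1
    exact ⟨h1, le_rfl⟩
  | stepA _ ih =>
    exact ⟨(h.A_q _).trans (A.mono ih.1), (A.mono ih.2).trans (h.A_p _)⟩
  | stepB _ ih =>
    exact ⟨(h.B_p _).trans (B.mono ih.1), (B.mono ih.2).trans (h.B_q _)⟩
  | stepBB _ ih =>
    exact ⟨(h.BB_p _).trans (B.mono (B.mono ih.1)), (B.mono (B.mono ih.2)).trans (h.BB_q _)⟩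

theorem add_int {s : Bool} {n : ℤ} {y y' : ℝ} (h : Itinerary A B A' B' k a b x x' s n y y')
    (m : ℤ) : Itinerary A B A' B' k a b x x' s (n + k * m) (y + m) (y' + m) := by
  induction h with
  | left j =>
    convert left (A := A) (B := B) (A' := A') (B' := B') (a := a) (b := b) (x := x) (x' := x')
      (k := k) (j + m) using 1 <;> push_cast <;> ring
  | right j =>
    convert right (A := A) (B := B) (A' := A') (B' := B') (a := a) (b := b) (x := x) (x' := x')
      (k := k) (j + m) using 1 <;> push_cast <;> ring
  | stepA _ ih =>
    convert stepA ih using 1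
    · ring
    all_goals simp
  | stepB _ ih =>
    convert stepB ih using 1
    · ring
    all_goals simp
  | stepBB _ ih =>
    convert stepBB ih using 1
    · ring
    all_goals simp

/-- If `A ∘ A` is the unit translation, applying `A` to both points leads to an itinerary again. -/
theorem exists_A (hA : ∀ y, A (A y) = y + 1) (hA' : ∀ y, A' (A' y) = y + 1) {s : Bool} {n : ℤ}
    {y y' : ℝ} (h : Itinerary A B A' B' k a b x x' s n y y') :
    ∃ s n, Itinerary A B A' B' k a b x x' s n (A y) (A' y') := by
  cases h with
  | left j => exact ⟨_, _, stepA (right j)⟩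
  | right j => exact ⟨_, _, stepA (right j)⟩
  | stepA h =>
    have := h.add_int 1
    rw [Int.cast_one, ← hA, ← hA'] at this
    exact ⟨_, _, this⟩
  | stepB h => exact ⟨_, _, stepA (stepB h)⟩
  | stepBB h => exact ⟨_, _, stepA (stepBB h)⟩

theorem exists_B {m : ℤ} (hB : ∀ y, B (B (B y)) = y + m) (hB' : ∀ y, B' (B' (B' y)) = y + m)
    {s : Bool} {n : ℤ} {y y' : ℝ} (h : Itinerary A B A' B' k a b x x' s n y y') :
    ∃ s n, Itinerary A B A' B' k a b x x' s n (B y) (B' y') := by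
  cases h with
  | left j => exact ⟨_, _, stepB (left j)⟩
  | right j => exact ⟨_, _, stepB (left j)⟩
  | stepA h => exact ⟨_, _, stepB (stepA h)⟩
  | stepB h => exact ⟨_, _, stepBB h⟩
  | stepBB h =>
    have := h.add_int m
    rw [← hB, ← hB'] at this
    exact ⟨_, _, this⟩

end Itinerary

/-- The action of the free group on the line generated by the lifts `A` and `B`. -/
def freeAction (A B : CircleDeg1Liftˣ) : FreeGroup (Fin 2) →* CircleDeg1Liftˣ :=
  FreeGroup.lift ![A, B]

@[simp] theorem freeAction_zero (A B : CircleDeg1Liftˣ) :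
    freeAction A B (FreeGroup.of 0) = A := by
  simp [freeAction]

@[simp] theorem freeAction_one (A B : CircleDeg1Liftˣ) :
    freeAction A B (FreeGroup.of 1) = B := by
  simp [freeAction]

theorem units_mul_apply (F G : CircleDeg1Liftˣ) (y : ℝ) : (F * G : CircleDeg1Liftˣ) y = F (G y) :=
  rfl

theorem units_strictMono (F : CircleDeg1Liftˣ) : StrictMono F :=
  (toOrderIso F).strictMono

theorem units_continuous (F : CircleDeg1Liftˣ) : Continuous (F : CircleDeg1Lift) := by
  rw [continuous_iff_surjective]
  exact (toOrderIso F).surjective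

section Rigidity

variable {A B A' B' : CircleDeg1Liftˣ} {k a b m : ℤ} {p q p' q' : ℤ → ℝ}

theorem inv_apply_of_sq (hA : ∀ y, A (A y) = y + 1) (y : ℝ) :
    (A⁻¹ : CircleDeg1Liftˣ) y = A (y + (-1 : ℤ)) := by
  apply (units_strictMono A).injective
  rw [units_apply_inv_apply, hA]
  simp

theorem inv_apply_of_cube (hB : ∀ y, B (B (B y)) = y + m) (y : ℝ) :
    (B⁻¹ : CircleDeg1Liftˣ) y = B (B (y + (-m : ℤ))) := by
  apply (units_strictMono B).injective
  rw [units_apply_inv_apply, hB]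
  simp

theorem exists_itinerary (hA : ∀ y, A (A y) = y + 1) (hA' : ∀ y, A' (A' y) = y + 1)
    (hB : ∀ y, B (B (B y)) = y + m) (hB' : ∀ y, B' (B' (B' y)) = y + m) (x x' : ℝ)
    (w : FreeGroup (Fin 2)) :
    ∃ s n, Itinerary A B A' B' k a b x x' s n (freeAction A B w x) (freeAction A' B' w x') := by
  suffices H : ∀ y y', (∃ s n, Itinerary A B A' B' k a b x x' s n y y') →
      ∃ s n, Itinerary A B A' B' k a b x x' s n (freeAction A B w y) (freeAction A' B' w y') by
    refine H x x' ⟨false, k * 0, ?_⟩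
    simpa using Itinerary.left (A := A) (B := B) (A' := A') (B' := B') (k := k) (a := a) (b := b)
      (x := x) (x' := x') 0
  induction w using FreeGroup.induction_on with
  | C1 => exact fun _ _ h => h
  | of i =>
    rintro y y' ⟨s, n, h⟩
    fin_cases i
    · simpa using h.exists_A hA hA'
    · simpa using h.exists_B hB hB'
  | inv_of i _ =>
    rintro y y' ⟨s, n, h⟩
    fin_cases i
    · obtain ⟨_, _, h⟩ := (h.add_int (-1)).exists_A hA hA'
      rw [← inv_apply_of_sq hA, ← inv_apply_of_sq hA'] at h
      have hw : ∃ s n, Itinerary A B A' B' k a b x x' s n _ _ := ⟨_, _, h⟩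
      simpa using hw
    · obtain ⟨_, _, h⟩ := (h.add_int (-m)).exists_B hB hB'
      obtain ⟨_, _, h⟩ := h.exists_B hB hB'
      rw [← inv_apply_of_cube hB, ← inv_apply_of_cube hB'] at h
      have hw : ∃ s n, Itinerary A B A' B' k a b x x' s n _ _ := ⟨_, _, h⟩
      simpa using hw
  | mul v w hv hw =>
    intro y y' h
    rw [map_mul, map_mul, units_mul_apply, units_mul_apply]
    exact hv _ _ (hw _ _ h)

theorem IsPingPong.monotone {A B : CircleDeg1Lift} (h : IsPingPong A B k a b p q) : Monotone p :=
  monotone_int_of_le_succ fun n => (h.le n).trans (h.le' n)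

/-- The `n`-th points of two partitions with the same `k` are within bounded distance. -/
theorem IsPingPong.abs_sub_le {A B A' B' : CircleDeg1Lift} (hk : 0 < k)
    (h : IsPingPong A B k a b p q) (h' : IsPingPong A' B' k a b p' q') (n : ℤ) :
    |p n - p' n| ≤ |p 0 - p' 0| + 1 := by
  have e : n = n % k + k * (n / k) := (Int.emod_add_mul_ediv n k).symm
  rw [e, h.p_add_mul, h'.p_add_mul]
  have h0 : 0 ≤ n % k := Int.emod_nonneg _ hk.ne'
  have h1 : n % k ≤ 0 + k := by have := Int.emod_lt_of_pos n hk; omega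
  have a0 := h.monotone h0
  have a1 := h.monotone h1
  have b0 := h'.monotone h0
  have b1 := h'.monotone h1
  rw [h.p_add] at a1
  rw [h'.p_add] at b1
  have := neg_abs_le (p 0 - p' 0)
  have := le_abs_self (p 0 - p' 0)
  rw [abs_le]
  constructor <;> linarith

/-- The two orbits of the base points under a word have the same itinerary, hence stay close. -/
theorem abs_freeAction_sub_le (hk : 0 < k) (hA : ∀ y, A (A y) = y + 1)
    (hA' : ∀ y, A' (A' y) = y + 1)
    (hB : ∀ y, B (B (B y)) = y + m) (hB' : ∀ y, B' (B' (B' y)) = y + m)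
    (h : IsPingPong A B k a b p q) (h' : IsPingPong A' B' k a b p' q') (w : FreeGroup (Fin 2)) :
    |freeAction A B w (p 0) - freeAction A' B' w (p' 0)| ≤ |p 0 - p' 0| + 2 := by
  obtain ⟨s, n, hi⟩ := exists_itinerary (k := k) (a := a) (b := b) hA hA' hB hB' (p 0) (p' 0) w
  have h1 : freeAction A B w (p 0) ∈ Set.Icc (p n) (p (n + 1)) := by
    have := hi.mem_Icc h
    cases s
    · exact Set.Icc_subset_Icc_right (h.le' n) this
    · exact Set.Icc_subset_Icc_left (h.le n) this
  have h2 : freeAction A' B' w (p' 0) ∈ Set.Icc (p' n) (p' (n + 1)) := by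
    have := hi.swap.mem_Icc h'
    cases s
    · exact Set.Icc_subset_Icc_right (h'.le' n) this
    · exact Set.Icc_subset_Icc_left (h'.le n) this
  have c1 : p (n + 1) ≤ p n + 1 := by
    rw [← h.p_add]; exact h.monotone (by omega)
  have c2 : p' (n + 1) ≤ p' n + 1 := by
    rw [← h'.p_add]; exact h'.monotone (by omega)
  have h3 := abs_le.1 (h.abs_sub_le hk h' n)
  rw [abs_le]
  constructor <;> linarith [h1.1, h1.2, h2.1, h2.2]

theorem map_zero_bounds (f : CircleDeg1Lift) (x : ℝ) :
    f x + ⌊-x⌋ ≤ f 0 ∧ f 0 ≤ f x + ⌈-x⌉ := by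
  constructor
  · rw [← map_add_int]
    exact f.mono (by linarith [Int.floor_le (-x)])
  · rw [← map_add_int]
    exact f.mono (by linarith [Int.le_ceil (-x)])

theorem translationNumber_freeAction_eq (hk : 0 < k) (hA : ∀ y, A (A y) = y + 1)
    (hA' : ∀ y, A' (A' y) = y + 1)
    (hB : ∀ y, B (B (B y)) = y + m) (hB' : ∀ y, B' (B' (B' y)) = y + m)
    (h : IsPingPong A B k a b p q) (h' : IsPingPong A' B' k a b p' q') (w : FreeGroup (Fin 2)) :
    translationNumber (freeAction A B w : CircleDeg1Lift) =
      translationNumber (freeAction A' B' w : CircleDeg1Lift) := by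
  refine translationNumber_eq_of_dist_bounded
    (|p 0 - p' 0| + 2 + |(⌊-p 0⌋ : ℝ)| + |(⌈-p 0⌉ : ℝ)| + |(⌊-p' 0⌋ : ℝ)| + |(⌈-p' 0⌉ : ℝ)|)
    fun n => ?_
  have key := abs_le.1 (abs_freeAction_sub_le hk hA hA' hB hB' h h' (w ^ n))
  rw [map_pow, map_pow, Units.val_pow_eq_pow_val, Units.val_pow_eq_pow_val] at key
  have b1 := map_zero_bounds ((freeAction A B w : CircleDeg1Lift) ^ n) (p 0)
  have b2 := map_zero_bounds ((freeAction A' B' w : CircleDeg1Lift) ^ n) (p' 0)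
  have e1 := abs_le.1 (le_refl |(⌊-p 0⌋ : ℝ)|)
  have e2 := abs_le.1 (le_refl |(⌈-p 0⌉ : ℝ)|)
  have e3 := abs_le.1 (le_refl |(⌊-p' 0⌋ : ℝ)|)
  have e4 := abs_le.1 (le_refl |(⌈-p' 0⌉ : ℝ)|)
  rw [Real.dist_eq, abs_le]
  constructor <;> linarith

/-- Two pairs of lifts with ping-pong partitions of the same type generate semi-conjugate
actions; the semi-conjugacy obtained here need not be continuous. -/
theorem exists_semiconj (hk : 0 < k) (hA : ∀ y, A (A y) = y + 1)
    (hA' : ∀ y, A' (A' y) = y + 1)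
    (hB : ∀ y, B (B (B y)) = y + m) (hB' : ∀ y, B' (B' (B' y)) = y + m)
    (h : IsPingPong A B k a b p q) (h' : IsPingPong A' B' k a b p' q') :
    ∃ F : CircleDeg1Lift, ∀ (w : FreeGroup (Fin 2)) (y : ℝ),
      F (freeAction A B w y) = freeAction A' B' w (F y) := by
  obtain ⟨F, hF⟩ := semiconj_of_group_action_of_forall_translationNumber_eq
    ((Units.coeHom CircleDeg1Lift).comp (freeAction A B))
    ((Units.coeHom CircleDeg1Lift).comp (freeAction A' B'))
    (translationNumber_freeAction_eq hk hA hA' hB hB' h h')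
  exact ⟨F, fun w y => hF w y⟩

end Rigidity

/-! ### Ping-pong partitions from rotation numbers -/

section Partition

variable {A B : CircleDeg1Liftˣ}

theorem lt_of_sq (hA : ∀ y, A (A y) = y + 1) (y : ℝ) : y < A y := by
  by_contra! h
  have := (units_strictMono A).monotone h
  rw [hA] at this
  linarith

theorem lt_add_one_of_sq (hA : ∀ y, A (A y) = y + 1) (y : ℝ) : A y < y + 1 := by
  rw [← hA]
  exact units_strictMono A (lt_of_sq hA y)

theorem lt_of_cube {m : ℤ} (hm : 0 < m) (hB : ∀ y, B (B (B y)) = y + m) (y : ℝ) : y < B y := by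
  by_contra! h
  have h1 := (units_strictMono B).monotone h
  have h2 := (units_strictMono B).monotone h1
  rw [hB] at h2
  have : (0 : ℝ) < m := by exact_mod_cast hm
  linarith

theorem lt_add_one_of_cube {m : ℤ} (hm : m < 3) (hB : ∀ y, B (B (B y)) = y + m) (y : ℝ) :
    B y < y + 1 := by
  by_contra! h
  have h1 := (units_strictMono B).monotone h
  have h2 := (units_strictMono B).monotone h1
  rw [hB, map_add_one, map_add_one] at h2
  rw [map_add_one] at h1
  have : (m : ℝ) < 3 := by exact_mod_cast hm
  linarith

/-- A product of lifts of rotation numbers `1/2` and `1/3` with a fixed point on the circle has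
translation number one, and the fixed points of `A⁻¹ B` give a partition. -/
theorem exists_map_eq_map (hA : ∀ y, A (A y) = y + 1) (hB : ∀ y, B (B (B y)) = y + (1 : ℤ)) {N : ℤ}
    (h : translationNumber ((A * B : CircleDeg1Liftˣ) : CircleDeg1Lift) = N) :
    ∃ x, A x = B x := by
  obtain ⟨x, hx⟩ := (translationNumber_eq_int_iff _ (units_continuous (A * B))).1 h
  rw [units_mul_apply] at hx
  have hB0 := lt_of_cube one_pos hB x
  have hB1 := lt_add_one_of_cube (by norm_num) hB x
  have hA0 := lt_of_sq hA (B x)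
  have hA1 := lt_add_one_of_sq hA (B x)
  have hN : N = 1 := by
    have h1 : (0 : ℝ) < N := by linarith
    have h2 : (N : ℝ) < 2 := by linarith
    have h1 : 0 < N := by exact_mod_cast h1
    have h2 : N < 2 := by exact_mod_cast h2
    omega
  rw [hN, Int.cast_one, ← hA x] at hx
  exact ⟨x, ((units_strictMono A).injective hx).symm⟩

theorem isPingPong_one (hA : ∀ y, A (A y) = y + 1) (hB : ∀ y, B (B (B y)) = y + (1 : ℤ)) {x : ℝ}
    (hx : A x = B x) :
    IsPingPong A B 1 0 0 (fun n => x + n) (fun n => A x + n) where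
  le n := by linarith [lt_of_sq hA x]
  le' n := by
    push_cast
    linarith [lt_add_one_of_sq hA x]
  p_add n := by
    push_cast
    ring
  A_q n := by
    rw [map_add_int, hA]
    push_cast
    linarith
  A_p n := by
    rw [map_add_int]
    simp
  B_p n := by
    rw [map_add_int, hx]
    simp
  B_q n := by
    have := (lt_of_cube one_pos hB (B (B x))).le
    rw [hB] at this
    rw [map_add_int, hx]
    push_cast at this ⊢
    linarith
  BB_p n := by
    rw [map_add_int, map_add_int, hx]
    have := (lt_of_cube one_pos hB (B x)).le
    simp only [mul_zero, add_zero]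
    linarith
  BB_q n := by
    rw [map_add_int, map_add_int, hx, hB]
    push_cast
    linarith

/-- The translation number of a product of lifts of rotation numbers `1/2` and `2/3` is at least
one: otherwise `B < A` pointwise, and `B³` would move points by less than `2`. -/
theorem one_le_translationNumber (hA : ∀ y, A (A y) = y + 1)
    (hB : ∀ y, B (B (B y)) = y + (2 : ℤ)) :
    1 ≤ translationNumber ((A * B : CircleDeg1Liftˣ) : CircleDeg1Lift) := by
  by_contra! h
  have hlt : ∀ y, B y < A y := by
    intro y
    have := map_lt_of_translationNumber_lt_int (n := 1) _ (by simpa using h) y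
    rw [mul_apply, Int.cast_one, ← hA] at this
    exact (units_strictMono A).lt_iff_lt.1 this
  have h2 : B (B 0) < 0 + 1 := by
    rw [← hA]
    exact (units_strictMono B (hlt 0)).trans (hlt _)
  have h3 := units_strictMono B h2
  rw [hB, map_add_one] at h3
  have := lt_add_one_of_sq hA 0
  have := hlt 0
  push_cast at h3
  linarith

theorem translationNumber_le_two (hA : ∀ y, A (A y) = y + 1)
    (hB : ∀ y, B (B (B y)) = y + (2 : ℤ)) :
    translationNumber ((A * B : CircleDeg1Liftˣ) : CircleDeg1Lift) ≤ 2 := by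
  refine translationNumber_le_of_le_add _ fun y => ?_
  rw [units_mul_apply]
  linarith [lt_add_one_of_sq hA (B y), lt_add_one_of_cube (by norm_num) hB y]

theorem exists_pow_five_eq (hA : ∀ y, A (A y) = y + 1) (hB : ∀ y, B (B (B y)) = y + (2 : ℤ)) {N : ℤ}
    (h : translationNumber ((A * B : CircleDeg1Liftˣ) : CircleDeg1Lift) = 1 / 5 + N) :
    ∃ x, ((A * B : CircleDeg1Liftˣ) ^ 5 : CircleDeg1Liftˣ) x = x + 6 := by
  have h1 := one_le_translationNumber hA hB
  have h2 := translationNumber_le_two hA hB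
  have hN : N = 1 := by
    have h3 : (0 : ℝ) < N := by linarith
    have h4 : (N : ℝ) < 2 := by linarith
    have h3 : 0 < N := by exact_mod_cast h3
    have h4 : N < 2 := by exact_mod_cast h4
    omega
  have h5 : translationNumber ((A * B : CircleDeg1Liftˣ) : CircleDeg1Lift)
      = (6 : ℤ) / (5 : ℕ) := by
    rw [h, hN]
    norm_num
  obtain ⟨x, hx⟩ := (translationNumber_eq_rat_iff _ (units_continuous (A * B)) (by norm_num)).1 h5
  refine ⟨x, ?_⟩
  rw [Units.val_pow_eq_pow_val, hx]
  simp

/-- The shape of the orbit of a point with `(A B)⁵ x = x + 6`: the points `p j` are the translates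
of the points of the orbit in their order on the line, `q j = B (p j)`. -/
structure IsFiveOrbit (A B : CircleDeg1Liftˣ) (p q : ℤ → ℝ) : Prop where
  strictMono : StrictMono p
  p_add : ∀ n, p (n + 5) = p n + 1
  q_add : ∀ n, q (n + 5) = q n + 1
  B_p : ∀ n, B (p n) = q n
  A_p : ∀ n, A (p n) = q (n - 1)
  A_q : ∀ n, A (q n) = p (n + 6)
  BB_q : ∀ n, B (B (q n)) = p (n + 10)

theorem exists_isFiveOrbit (hA : ∀ y, A (A y) = y + 1) (hB : ∀ y, B (B (B y)) = y + (2 : ℤ)) {x : ℝ}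
    (h : ((A * B : CircleDeg1Liftˣ) ^ 5 : CircleDeg1Liftˣ) x = x + 6) :
    ∃ p q, p 0 = x ∧ IsFiveOrbit A B p q := by
  -- `D y = A (B y) - 1` is the lift of `A B` moving each translate of the orbit to the next one
  set D : CircleDeg1Liftˣ := (translate (Multiplicative.ofAdd (1 : ℝ)))⁻¹ * (A * B) with hD
  have hD1 : ∀ y, D y = A (B y) - 1 := by
    intro y
    rw [hD, units_mul_apply, translate_inv_apply, units_mul_apply]
    ring
  have hD5 : (D ^ 5 : CircleDeg1Liftˣ) x = x + 1 := by
    simp only [pow_succ, pow_zero, one_mul, units_mul_apply] at h ⊢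
    simp only [hD1]
    have e : ∀ y : ℝ, A (B (y - 1)) = A (B y) - 1 := by
      intro y
      have h1 := map_sub_int (B : CircleDeg1Lift) y 1
      have h2 := map_sub_int (A : CircleDeg1Lift) (B y) 1
      push_cast at h1 h2
      rw [h1, h2]
    simp only [e, h]
    ring
  have hlt : x < D x := by
    by_contra! hle
    have := (iterate_pos_le_iff (D : CircleDeg1Lift) (x := x) (m := 0) (n := 5) (by norm_num)).2
      (by simpa using hle)
    rw [← coe_pow, ← Units.val_pow_eq_pow_val, hD5] at this
    norm_num at this
  set p : ℤ → ℝ := fun j => (D ^ j : CircleDeg1Liftˣ) x with hp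
  have hps : ∀ j, p (j + 1) = D (p j) := fun j => by
    simp only [hp]
    rw [add_comm, zpow_add, zpow_one, units_mul_apply]
  have hmono : StrictMono p := by
    refine strictMono_int_of_lt_succ fun j => ?_
    simp only [hp]
    rw [zpow_add, zpow_one, units_mul_apply]
    exact units_strictMono _ hlt
  have hp5 : ∀ j, p (j + 5) = p j + 1 := fun j => by
    simp only [hp]
    rw [zpow_add, units_mul_apply]
    norm_cast
    rw [hD5, map_add_one]
  have hAB : ∀ j, A (B (p j)) = p (j + 6) := fun j => by
    have h1 := hD1 (p j)
    have h2 := hp5 (j + 1)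
    rw [hps, h1, show j + 1 + 5 = j + 6 by ring] at h2
    linarith
  refine ⟨p, fun j => B (p j), by simp [hp], hmono, hp5, fun j => by rw [hp5, map_add_one],
    fun _ => rfl, fun j => ?_, hAB, fun j => ?_⟩
  · apply (units_strictMono A).injective
    rw [hA, hAB, ← hp5]
    congr 1
    ring
  · rw [hB, show j + 10 = j + 5 + 5 by ring, hp5, hp5]
    push_cast
    ring

namespace IsFiveOrbit

variable {p q : ℤ → ℝ} (h : IsFiveOrbit A B p q)

include h

theorem p_le_q_iff (i j : ℤ) : p i ≤ q j ↔ q (i - 1) ≤ p (j + 6) := by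
  rw [← h.A_p, ← h.A_q]
  exact (units_strictMono A).le_iff_le.symm

theorem q_le_Bq_iff (i j : ℤ) : q i ≤ B (q j) ↔ p i ≤ q j := by
  rw [← h.B_p i]
  exact (units_strictMono B).le_iff_le

theorem Bq_le_p_iff (i j : ℤ) : B (q i) ≤ p (j + 10) ↔ p i ≤ q j := by
  rw [← h.q_le_Bq_iff, ← h.BB_q]
  exact (units_strictMono B).le_iff_le

/-- If `q` overtook `p` by four steps at two consecutive indices, the inequalities transported by
`A` and `B` would improve to `p (j + 5) ≤ q j`, and then contradict `B³ = T²`. -/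
theorem not_p_le_q_and (j : ℤ) : ¬(p (j + 4) ≤ q j ∧ p (j + 5) ≤ q (j + 1)) := by
  rintro ⟨h0, h1⟩
  have a1 : q (j + 4 + 5) ≤ B (q (j + 5)) := (h.q_le_Bq_iff _ _).2 (by
    rw [h.p_add, h.q_add]
    linarith)
  have a2 := (h.Bq_le_p_iff (j + 5) (j + 1)).2 h1
  rw [show j + 1 + 10 = j + 6 + 5 by ring, h.p_add] at a2
  rw [h.q_add] at a1
  have a3 : p (j + 5) ≤ q j := (h.p_le_q_iff _ _).2 (by
    rw [show j + 5 - 1 = j + 4 by ring]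
    linarith)
  have a4 := (h.Bq_le_p_iff _ _).2 a3
  have a5 : p (j + 10) ≤ q (j + 5) := by
    rw [show j + 10 = j + 5 + 5 by ring, h.p_add, h.q_add]
    linarith
  have a6 := (h.q_le_Bq_iff _ _).2 a5
  have a7 : q (j + 10) = q j + 1 + 1 := by
    rw [show j + 10 = j + 5 + 5 by ring, h.q_add, h.q_add]
  have a8 : p (j + 10) = p (j + 5) + 1 := by
    rw [show j + 10 = j + 5 + 5 by ring, h.p_add]
  linarith

/-- The main inequality: the point `q j = B (p j)` lies to the left of `p (j + 4)`. -/
theorem q_lt (j : ℤ) : q j < p (j + 4) := by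
  by_contra! h0
  have a1 : B (q (j + 4)) ≤ p (j + 10) := (h.Bq_le_p_iff _ _).2 h0
  have a2 : p (j + 7) < q (j + 4) := by
    by_contra! h1
    refine h.not_p_le_q_and j ⟨h0, (h.p_le_q_iff _ _).2 ?_⟩
    rwa [show j + 5 - 1 = j + 4 by ring, show j + 1 + 6 = j + 7 by ring]
  have a3 : q (j + 7) ≤ B (q (j + 4)) := (h.q_le_Bq_iff _ _).2 a2.le
  have a4 : p (j + 10) < q (j + 7) := by
    by_contra! h1
    refine h.not_p_le_q_and (j + 4) ⟨(h.p_le_q_iff _ _).2 ?_, ?_⟩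
    · rwa [show j + 4 + 4 - 1 = j + 7 by ring, show j + 4 + 6 = j + 10 by ring]
    · rw [show j + 4 + 5 = j + 4 + 5 by ring, show j + 4 + 1 = j + 5 by ring, h.p_add, h.q_add]
      linarith
  linarith

theorem lt_q (j : ℤ) : p (j + 3) < q j := by
  by_contra! h0
  have a := (h.p_le_q_iff (j + 2 + 4) (j + 2)).not.1 (h.q_lt _).not_ge
  apply a
  rw [show j + 2 + 4 - 1 = j + 5 by ring, show j + 2 + 6 = j + 3 + 5 by ring, h.p_add, h.q_add]
  linarith

theorem isPingPong : IsPingPong A B 5 2 3 p (fun n => q (n - 3)) where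
  le n := by simpa using (h.lt_q (n - 3)).le
  le' n := by
    have := (h.q_lt (n - 3)).le
    rwa [show n - 3 + 4 = n + 1 by ring] at this
  p_add := h.p_add
  A_q n := by
    rw [h.A_q]
    exact (congrArg p (by ring)).le
  A_p n := by
    rw [h.A_p]
    exact (congrArg q (by ring)).le
  B_p n := by
    rw [h.B_p]
    exact (congrArg q (by ring)).le
  B_q n := by
    have := (h.Bq_le_p_iff (n - 3) (n - 6)).2 (by
      have := (h.lt_q (n - 6)).le
      rwa [show n - 6 + 3 = n - 3 by ring] at this)
    rwa [show n - 6 + 10 = n + 3 + 1 by ring] at this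
  BB_p n := by
    rw [h.B_p, show n + 2 * 3 - 3 = n + 3 by ring]
    exact (h.q_le_Bq_iff _ _).2 (h.lt_q n).le
  BB_q n := by
    rw [h.BB_q]
    exact (congrArg p (by ring)).le

end IsFiveOrbit

end Partition

/-! ### Lifts of circle homeomorphisms -/

/-- `F` is a lift of the circle homeomorphism `f` to the line. -/
def IsLift (f : HomeoPlus) (F : CircleDeg1Liftˣ) : Prop :=
  ∀ x : ℝ, f.1 (x : UnitAddCircle) = ((F x : ℝ) : UnitAddCircle)

theorem IsLift.one : IsLift 1 1 := fun _ => rfl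

theorem IsLift.mul {f g : HomeoPlus} {F G : CircleDeg1Liftˣ} (hf : IsLift f F) (hg : IsLift g G) :
    IsLift (f * g) (F * G) := fun x => by
  rw [units_mul_apply, ← hf, ← hg]
  rfl

theorem IsLift.inv {f : HomeoPlus} {F : CircleDeg1Liftˣ} (hf : IsLift f F) :
    IsLift f⁻¹ F⁻¹ := fun x => by
  apply f.1.injective
  rw [hf, units_apply_inv_apply]
  exact f.1.apply_symm_apply _

theorem IsLift.pow {f : HomeoPlus} {F : CircleDeg1Liftˣ} (hf : IsLift f F) (n : ℕ) :
    IsLift (f ^ n) (F ^ n) := by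
  induction n with
  | zero => exact IsLift.one
  | succ n ih =>
    rw [pow_succ, pow_succ]
    exact ih.mul hf

theorem IsLift.eq_of {f g : HomeoPlus} {F : CircleDeg1Liftˣ} (hf : IsLift f F) (hg : IsLift g F) :
    f = g := by
  refine Subtype.ext (Homeomorph.ext fun x => ?_)
  induction x using QuotientAddGroup.induction_on with
  | H x => exact (hf x).trans (hg x).symm

/-- Adding an integer to a lift gives a lift. -/
theorem IsLift.translate_mul {f : HomeoPlus} {F : CircleDeg1Liftˣ} (hf : IsLift f F) (n : ℤ) :
    IsLift f (translate (Multiplicative.ofAdd (n : ℝ)) * F) := fun x => by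
  rw [units_mul_apply, translate_apply, AddCircle.coe_add, coe_int_eq_zero, zero_add, hf]

theorem translationNumber_translate_mul (F : CircleDeg1Liftˣ) (n : ℤ) :
    translationNumber
      ((translate (Multiplicative.ofAdd (n : ℝ)) * F : CircleDeg1Liftˣ) : CircleDeg1Lift) =
      n + translationNumber (F : CircleDeg1Lift) := by
  have hc : Commute (translate (Multiplicative.ofAdd (n : ℝ)) : CircleDeg1Lift)
      (F : CircleDeg1Lift) := by
    ext x
    simp [CircleDeg1Lift.mul_apply]
  rw [Units.val_mul, translationNumber_mul_of_commute hc, translationNumber_translate]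

/-- A lift of the identity is an integer translation. -/
theorem IsLift.exists_eq_add {F : CircleDeg1Liftˣ} (hF : IsLift 1 F) :
    ∃ n : ℤ, ∀ x, F x = x + n :=
  lift_unique F 1 fun x => (hF x).symm

theorem exists_lift_of_rot {f : HomeoPlus} {r : ℝ} (h : rot f = (r : UnitAddCircle)) :
    ∃ F, IsLift f F ∧ translationNumber (F : CircleDeg1Lift) = r := by
  obtain ⟨F, hF⟩ := f.2
  rw [rot_eq f F hF, coe_eq_coe] at h
  obtain ⟨n, hn⟩ := h
  refine ⟨translate (Multiplicative.ofAdd ((-n : ℤ) : ℝ)) * F, IsLift.translate_mul hF _, ?_⟩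
  rw [translationNumber_translate_mul, hn]
  push_cast
  ring

/-- An element of order dividing `n` and rotation number `m / n` has a lift whose `n`-th power is
the translation by `m`. -/
theorem exists_lift_pow_eq {f : HomeoPlus} {n : ℕ} (hn : n ≠ 0) {m : ℤ} (hf : f ^ n = 1)
    (h : rot f = ((m / n : ℝ) : UnitAddCircle)) :
    ∃ F, IsLift f F ∧ ∀ y, (F ^ n : CircleDeg1Liftˣ) y = y + m := by
  obtain ⟨F, hF, hτ⟩ := exists_lift_of_rot h
  refine ⟨F, hF, ?_⟩
  have h1 := hF.pow n
  rw [hf] at h1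
  obtain ⟨l, hl⟩ := h1.exists_eq_add
  have h2 := translationNumber_of_eq_add_int _ (hl 0)
  rw [Units.val_pow_eq_pow_val, translationNumber_pow, hτ, mul_div_cancel₀ _ (by exact_mod_cast hn)]
    at h2
  rwa [h2]

/-- The circle homeomorphism with lift `F`. -/
def ofLift (F : CircleDeg1Liftˣ) : HomeoPlus := by
  have hper : ∀ G : CircleDeg1Liftˣ,
      Function.Periodic (fun x : ℝ => ((G x : ℝ) : UnitAddCircle)) 1 := fun G x => by
    simp only [map_add_one, AddCircle.coe_add]
    rw [AddCircle.coe_period, add_zero]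
  have hcont : ∀ G : CircleDeg1Liftˣ, Continuous (hper G).lift := fun G =>
    (QuotientAddGroup.isQuotientMap_mk (N := AddSubgroup.zmultiples (1 : ℝ))).continuous_iff.2
      ((AddCircle.continuous_mk' (1 : ℝ)).comp (units_continuous G))
  refine ⟨⟨⟨(hper F).lift, (hper F⁻¹).lift, fun x => ?_, fun x => ?_⟩, hcont F, hcont F⁻¹⟩, F,
    fun _ => rfl⟩
  · induction x using QuotientAddGroup.induction_on with
    | H x => exact congrArg _ (units_inv_apply_apply F x)
  · induction x using QuotientAddGroup.induction_on with
    | H x => exact congrArg _ (units_apply_inv_apply F x)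

theorem isLift_ofLift (F : CircleDeg1Liftˣ) : IsLift (ofLift F) F := fun _ => rfl

/-! ### Actions of the modular group and their lifts -/

theorem α_sq : α ^ 2 = 1 :=
  PresentedGroup.one_of_mem (rels := modularRels) (Or.inl rfl)

theorem β_cube : β ^ 3 = 1 :=
  PresentedGroup.one_of_mem (rels := modularRels) (Or.inr rfl)

theorem isLift_freeAction {φ : Gam →* HomeoPlus} {A B : CircleDeg1Liftˣ} (hA : IsLift (φ α) A)
    (hB : IsLift (φ β) B) (w : FreeGroup (Fin 2)) :
    IsLift (φ (PresentedGroup.mk modularRels w)) (freeAction A B w) := by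
  have hof : ∀ i : Fin 2, IsLift (φ (PresentedGroup.mk modularRels (FreeGroup.of i)))
      (freeAction A B (FreeGroup.of i)) := by
    intro i
    fin_cases i
    · rw [← freeAction_zero A B] at hA
      exact hA
    · rw [← freeAction_one A B] at hB
      exact hB
  induction w using FreeGroup.induction_on with
  | C1 => simpa using IsLift.one
  | of i => exact hof i
  | inv_of i _ =>
    rw [map_inv, map_inv, map_inv]
    exact (hof i).inv
  | mul v w hv hw =>
    rw [map_mul, map_mul, map_mul]
    exact hv.mul hw

/-- A continuous semi-conjugacy of the lifted actions of the free group descends to the circle. -/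
theorem semiConjugate_of_lift {φ φ' : Gam →* HomeoPlus} {A B A' B' : CircleDeg1Liftˣ}
    (hA : IsLift (φ α) A) (hB : IsLift (φ β) B) (hA' : IsLift (φ' α) A') (hB' : IsLift (φ' β) B')
    {F : CircleDeg1Lift} (hc : Continuous F)
    (hF : ∀ (w : FreeGroup (Fin 2)) (y : ℝ), F (freeAction A B w y) = freeAction A' B' w (F y)) :
    SemiConjugate φ φ' := by
  have hper : Function.Periodic (fun x : ℝ => ((F x : ℝ) : UnitAddCircle)) 1 := fun x => by
    simp only [map_add_one, AddCircle.coe_add]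
    rw [AddCircle.coe_period, add_zero]
  refine ⟨hper.lift, F, hc, fun _ => rfl, fun γ x => ?_⟩
  obtain ⟨w, rfl⟩ := PresentedGroup.mk_surjective modularRels γ
  induction x using QuotientAddGroup.induction_on with
  | H x =>
    have h1 := isLift_freeAction hA hB w x
    have h2 := isLift_freeAction hA' hB' w (F x)
    rw [← hF] at h2
    exact (congrArg hper.lift h1).trans h2.symm

theorem mem_subgroup_of_gens (S : Subgroup Gam) (hα : α ∈ S) (hβ : β ∈ S) (γ : Gam) : γ ∈ S := by
  have : Subgroup.closure (Set.range (PresentedGroup.of (rels := modularRels))) ≤ S := by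
    rw [Subgroup.closure_le]
    rintro _ ⟨i, rfl⟩
    fin_cases i
    · exact hα
    · exact hβ
  rw [PresentedGroup.closure_range_of] at this
  exact this trivial

/-! ### The Fuchsian action -/

theorem fuchsian_α_eq : fuchsian α =
    moebius (Matrix.SpecialLinearGroup.map (Int.castRingHom ℝ) matA) :=
  Subtype.ext (Homeomorph.ext fun x => by
    rw [← circleToLine.injective.eq_iff, fuchsian_α]
    exact (circleToLine.apply_symm_apply _).symm)

theorem fuchsian_β_eq : fuchsian β =
    moebius (Matrix.SpecialLinearGroup.map (Int.castRingHom ℝ) matB) :=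
  Subtype.ext (Homeomorph.ext fun x => by
    rw [← circleToLine.injective.eq_iff, fuchsian_β]
    exact (circleToLine.apply_symm_apply _).symm)

theorem circleToLine_moebius (g : SL(2, ℝ)) (x : UnitAddCircle) :
    circleToLine ((moebius g).1 x) = Matrix.SpecialLinearGroup.toGL g • circleToLine x :=
  circleToLine.apply_symm_apply _

theorem matA_apply :
    matA 0 0 = 0 ∧ matA 0 1 = -1 ∧ matA 1 0 = 1 ∧ matA 1 1 = 0 :=
  ⟨rfl, rfl, rfl, rfl⟩

theorem matA_smul_infty : Matrix.SpecialLinearGroup.toGL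
    (Matrix.SpecialLinearGroup.map (Int.castRingHom ℝ) matA) • (OnePoint.infty : OnePoint ℝ) =
    ((0 : ℝ) : OnePoint ℝ) := by
  simp [OnePoint.smul_infty_eq_ite, matA_apply]

theorem matA_smul_coe (t : ℝ) : Matrix.SpecialLinearGroup.toGL
    (Matrix.SpecialLinearGroup.map (Int.castRingHom ℝ) matA) • (t : OnePoint ℝ) =
    if t = 0 then OnePoint.infty else ((-1 / t : ℝ) : OnePoint ℝ) := by
  simp [OnePoint.smul_some_eq_ite, matA_apply]

theorem matB_apply :
    matB 0 0 = 1 ∧ matB 0 1 = 1 ∧ matB 1 0 = -1 ∧ matB 1 1 = 0 :=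
  ⟨rfl, rfl, rfl, rfl⟩

theorem matB_smul_infty : Matrix.SpecialLinearGroup.toGL
    (Matrix.SpecialLinearGroup.map (Int.castRingHom ℝ) matB) • (OnePoint.infty : OnePoint ℝ) =
    ((-1 : ℝ) : OnePoint ℝ) := by
  simp [OnePoint.smul_infty_eq_ite, matB_apply]

theorem matB_smul_coe (t : ℝ) : Matrix.SpecialLinearGroup.toGL
    (Matrix.SpecialLinearGroup.map (Int.castRingHom ℝ) matB) • (t : OnePoint ℝ) =
    if t = 0 then OnePoint.infty else (((t + 1) / -t : ℝ) : OnePoint ℝ) := by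
  simp [OnePoint.smul_some_eq_ite, matB_apply]

theorem linePoint_zero : linePoint 0 = ((0 : ℝ) : OnePoint ℝ) := by
  simp [linePoint]

theorem linePoint_half : linePoint (1 / 2) = OnePoint.infty := by
  rw [linePoint, if_pos]
  rw [show Real.pi * (1 / 2) = Real.pi / 2 by ring, Real.cos_pi_div_two]

theorem linePoint_three_quarters : linePoint (3 / 4) = ((-1 : ℝ) : OnePoint ℝ) := by
  have h : Real.pi * (3 / 4) = Real.pi - Real.pi / 4 := by ring
  rw [linePoint, h, Real.cos_pi_sub, Real.tan_pi_sub, Real.tan_pi_div_four, if_neg]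
  rw [Real.cos_pi_div_four]
  exact neg_ne_zero.2 (by positivity)

/-- The generator `α` acts as the rotation by `1/2`. -/
theorem isLift_fuchsian_α :
    IsLift (fuchsian α) (translate (Multiplicative.ofAdd (1 / 2 : ℝ))) := fun x => by
  rw [← circleToLine.injective.eq_iff, fuchsian_α, circleToLine_coe, circleToLine_coe,
    translate_apply]
  have e : Real.pi * (1 / 2 + x) = Real.pi * x + Real.pi / 2 := by ring
  by_cases hc : Real.cos (Real.pi * x) = 0
  · have hs : Real.sin (Real.pi * x) ≠ 0 := by
      intro hs
      have := Real.sin_sq_add_cos_sq (Real.pi * x)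
      rw [hs, hc] at this
      norm_num at this
    rw [linePoint, if_pos hc, matA_smul_infty, linePoint, e, Real.cos_add_pi_div_two,
      Real.tan_eq_sin_div_cos, Real.sin_add_pi_div_two, hc, if_neg (by simpa using hs)]
    simp
  · rw [linePoint, if_neg hc, matA_smul_coe, linePoint, e, Real.cos_add_pi_div_two,
      Real.tan_eq_sin_div_cos, Real.tan_eq_sin_div_cos, Real.sin_add_pi_div_two,
      Real.cos_add_pi_div_two]
    by_cases hs : Real.sin (Real.pi * x) = 0
    · simp [hs]
    · rw [if_neg (div_ne_zero hs hc), if_neg (neg_ne_zero.2 hs)]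
      congr 1
      field_simp

theorem fuchsian_β_zero : (fuchsian β).1 ((0 : ℝ) : UnitAddCircle) =
    ((1 / 2 : ℝ) : UnitAddCircle) := by
  rw [← circleToLine.injective.eq_iff, fuchsian_β, circleToLine_coe, circleToLine_coe,
    linePoint_zero, linePoint_half, matB_smul_coe, if_pos rfl]

theorem fuchsian_β_half : (fuchsian β).1 ((1 / 2 : ℝ) : UnitAddCircle) =
    ((3 / 4 : ℝ) : UnitAddCircle) := by
  rw [← circleToLine.injective.eq_iff, fuchsian_β, circleToLine_coe, circleToLine_coe,
    linePoint_half, linePoint_three_quarters, matB_smul_infty]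

theorem fuchsian_β_three_quarters : (fuchsian β).1 ((3 / 4 : ℝ) : UnitAddCircle) =
    ((0 : ℝ) : UnitAddCircle) := by
  rw [← circleToLine.injective.eq_iff, fuchsian_β, circleToLine_coe, circleToLine_coe,
    linePoint_zero, linePoint_three_quarters, matB_smul_coe, if_neg (by norm_num)]
  norm_num

/-- The lift of `β` that sends `0` to `1/2`. Following the orbit `0 ↦ 1/2 ↦ 3/4 ↦ 1` shows that
its cube is the unit translation. -/
theorem exists_lift_fuchsian_β : ∃ B, IsLift (fuchsian β) B ∧ B 0 = 1 / 2 ∧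
    ∀ y, B (B (B y)) = y + (1 : ℤ) := by
  obtain ⟨G, hG⟩ := (fuchsian β).2
  have h0 := hG 0
  rw [fuchsian_β_zero, coe_eq_coe] at h0
  obtain ⟨n, hn⟩ := h0
  set B := translate (Multiplicative.ofAdd (n : ℝ)) * G with hBdef
  have hB : IsLift (fuchsian β) B := IsLift.translate_mul hG n
  have b0 : B 0 = 1 / 2 := by
    rw [hBdef, units_mul_apply, translate_apply, hn]
    ring
  have b1 : B 1 = 3 / 2 := by
    have := map_add_one (B : CircleDeg1Lift) 0
    rw [zero_add, b0] at this
    rw [this]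
    norm_num
  have b2 : B (1 / 2) = 3 / 4 := by
    have h := hB (1 / 2)
    rw [fuchsian_β_half, eq_comm, coe_eq_coe] at h
    obtain ⟨j, hj⟩ := h
    have l1 := units_strictMono B (show (0 : ℝ) < 1 / 2 by norm_num)
    have l2 := units_strictMono B (show (1 / 2 : ℝ) < 1 by norm_num)
    rw [b0, hj] at l1
    rw [b1, hj] at l2
    have l1 : (-1 : ℝ) < j := by linarith
    have l2 : (j : ℝ) < 1 := by linarith
    have l1 : -1 < j := by exact_mod_cast l1
    have l2 : j < 1 := by exact_mod_cast l2
    obtain rfl : j = 0 := by omega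
    rw [hj]
    simp
  have b3 : B (3 / 4) = 1 := by
    have h := hB (3 / 4)
    rw [fuchsian_β_three_quarters, eq_comm, coe_eq_coe] at h
    obtain ⟨j, hj⟩ := h
    have l1 := units_strictMono B (show (1 / 2 : ℝ) < 3 / 4 by norm_num)
    have l2 := units_strictMono B (show (3 / 4 : ℝ) < 1 by norm_num)
    rw [b2, hj] at l1
    rw [b1, hj] at l2
    have l1 : (0 : ℝ) < j := by linarith
    have l2 : (j : ℝ) < 2 := by linarith
    have l1 : 0 < j := by exact_mod_cast l1
    have l2 : j < 2 := by exact_mod_cast l2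
    obtain rfl : j = 1 := by omega
    rw [hj]
    simp
  refine ⟨B, hB, b0, ?_⟩
  have h3 := hB.pow 3
  rw [← map_pow, β_cube, map_one] at h3
  obtain ⟨l, hl⟩ := h3.exists_eq_add
  simp only [pow_succ, pow_zero, one_mul, units_mul_apply] at hl
  have := hl 0
  rw [b0, b2, b3, zero_add] at this
  intro y
  rw [hl, Int.cast_one, ← this]

/-- The parabolic element `α⁻¹ β` fixes only the point `0`. -/
theorem eq_zero_of_fuchsian_eq {x : UnitAddCircle} (h : (fuchsian α).1 x = (fuchsian β).1 x) :
    x = 0 := by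
  have h0 : (0 : UnitAddCircle) = ((0 : ℝ) : UnitAddCircle) := rfl
  rw [← circleToLine.injective.eq_iff] at h ⊢
  rw [fuchsian_α, fuchsian_β] at h
  rw [h0, circleToLine_coe, linePoint_zero]
  generalize circleToLine x = l at *
  induction l using OnePoint.rec with
  | infty =>
    rw [matA_smul_infty, matB_smul_infty, OnePoint.coe_eq_coe] at h
    norm_num at h
  | coe t =>
    by_cases ht : t = 0
    · rw [ht]
    · rw [matA_smul_coe, matB_smul_coe, if_neg ht, if_neg ht, OnePoint.coe_eq_coe] at h
      field_simp at h
      exact absurd (by linarith) ht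

theorem moebius_mem_range (g : SL(2, ℤ)) :
    moebius (Matrix.SpecialLinearGroup.map (Int.castRingHom ℝ) g) ∈ fuchsian.range := by
  have : Subgroup.closure {ModularGroup.S, ModularGroup.T} ≤ fuchsian.range.comap
      (moebius.comp (Matrix.SpecialLinearGroup.map (Int.castRingHom ℝ))) := by
    rw [Subgroup.closure_le]
    rintro _ (rfl | rfl)
    · exact ⟨α, fuchsian_α_eq⟩
    · refine ⟨(β * α)⁻¹, ?_⟩
      have hT : ModularGroup.T = (matB * matA)⁻¹ := by
        rw [eq_inv_iff_mul_eq_one]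
        decide
      rw [hT, map_inv, map_inv, map_mul, map_mul, fuchsian_α_eq, fuchsian_β_eq]
      rfl
  rw [SpecialLinearGroup.SL2Z_generators] at this
  exact this trivial

/-- Every rational point lies in the orbit of the point `0` of `ℝ ∪ {∞}`. -/
theorem exists_fuchsian_zero_eq (r : ℚ) :
    ∃ γ, circleToLine ((fuchsian γ).1 0) = ((r : ℝ) : OnePoint ℝ) := by
  obtain ⟨g, hg0, hg1⟩ := IsCoprime.exists_SL2_col (R := ℤ) (a := r.num) (b := r.den)
    (Rat.isCoprime_num_den r) 1
  obtain ⟨γ, hγ⟩ := moebius_mem_range g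
  refine ⟨γ, ?_⟩
  have h0 : circleToLine (0 : UnitAddCircle) = ((0 : ℝ) : OnePoint ℝ) :=
    (circleToLine_coe 0).trans linePoint_zero
  rw [hγ, circleToLine_moebius, h0]
  simp [OnePoint.smul_some_eq_ite, hg0, hg1, Rat.cast_def]

theorem exists_linePoint_rat {a b : ℝ} (hab : a < b) :
    ∃ t, a < t ∧ t < b ∧ ∃ r : ℚ, linePoint t = ((r : ℝ) : OnePoint ℝ) := by
  set n : ℤ := ⌊a + 1 / 2⌋
  have hn := Int.floor_le (a + 1 / 2)
  have hn' := Int.lt_floor_add_one (a + 1 / 2)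
  -- the part of `(a - n, b - n)` on which the tangent is continuous
  set b' := min (b - n) (1 / 2)
  have hb' : a - n < b' := lt_min (by linarith) (by linarith)
  have hb1 : b' ≤ b - n := min_le_left _ _
  have hb2 : b' ≤ 1 / 2 := min_le_right _ _
  set u := (2 * (a - n) + b') / 3 with hu
  set v := (a - n + 2 * b') / 3 with hv
  have hpi := Real.pi_pos
  have hu1 : -(Real.pi / 2) < Real.pi * u := by nlinarith
  have hv1 : Real.pi * v < Real.pi / 2 := by nlinarith
  have huv : Real.pi * u < Real.pi * v := by
    apply mul_lt_mul_of_pos_left _ hpi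
    linarith
  obtain ⟨r, hr1, hr2⟩ := exists_rat_btwn (Real.tan_lt_tan_of_lt_of_lt_pi_div_two hu1 hv1 huv)
  have l1 := Real.arctan_strictMono hr1
  have l2 := Real.arctan_strictMono hr2
  rw [Real.arctan_tan hu1 (huv.trans hv1)] at l1
  rw [Real.arctan_tan (hu1.trans huv) hv1] at l2
  refine ⟨Real.arctan r / Real.pi + n, ?_, ?_, r, ?_⟩
  · have : u < Real.arctan r / Real.pi := by
      rw [lt_div_iff₀ hpi]
      linarith
    linarith
  · have : Real.arctan r / Real.pi < v := by
      rw [div_lt_iff₀ hpi]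
      linarith
    linarith
  · have h1 : linePoint (Real.arctan r / Real.pi + n) = linePoint (Real.arctan r / Real.pi) := by
      rw [linePoint_eq_iff, coe_eq_coe]
      exact ⟨n, rfl⟩
    have h2 : Real.pi * (Real.arctan r / Real.pi) = Real.arctan r := by field_simp
    rw [h1, linePoint, h2, if_neg (Real.cos_arctan_pos _).ne', Real.tan_arctan]

/-- A monotone equivariant map into a `k`-fold lift of the Fuchsian action is continuous as soon
as its range meets the fibre of the covering over the cusp `0` in all points: the range then
contains the preimage of the orbit of the cusp, which is dense. -/
theorem continuous_of_fibre_subset {k : ℕ} (hk : 0 < k) {ψ : Gam →* HomeoPlus}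
    (hψ : IsFoldLift k ψ fuchsian) (F : CircleDeg1Lift)
    (hinv : ∀ (γ : Gam) (y : ℝ), ∃ z, ((F z : ℝ) : UnitAddCircle) = (ψ γ).1 (F y : ℝ))
    (hfib : ∀ x : UnitAddCircle, k • x = 0 → ∃ y, ((F y : ℝ) : UnitAddCircle) = x) :
    Continuous F := by
  refine F.monotone.continuous_of_denseRange (dense_of_exists_between fun a b hab => ?_)
  have hk' : (0 : ℝ) < k := by exact_mod_cast hk
  obtain ⟨t, hat, htb, r, hr⟩ := exists_linePoint_rat (mul_lt_mul_of_pos_left hab hk')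
  obtain ⟨γ, hγ⟩ := exists_fuchsian_zero_eq r
  rw [← hr, ← circleToLine_coe, circleToLine.injective.eq_iff] at hγ
  have hkt : k • ((t / k : ℝ) : UnitAddCircle) = (t : UnitAddCircle) := by
    rw [← AddCircle.coe_nsmul, nsmul_eq_mul, mul_div_cancel₀ _ hk'.ne']
  have hz : k • ((ψ γ⁻¹).1 ((t / k : ℝ) : UnitAddCircle)) = 0 := by
    rw [hψ, hkt, ← hγ, map_inv]
    exact (fuchsian γ).1.symm_apply_apply _
  obtain ⟨y, hy⟩ := hfib _ hz
  obtain ⟨z, hz⟩ := hinv γ y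
  rw [hy, map_inv] at hz
  have hz' : ((F z : ℝ) : UnitAddCircle) = ((t / k : ℝ) : UnitAddCircle) :=
    hz.trans ((ψ γ).1.apply_symm_apply _)
  rw [eq_comm, coe_eq_coe] at hz'
  obtain ⟨n, hn⟩ := hz'
  refine ⟨t / k, ⟨z + n, by rw [map_add_int, hn]⟩, ?_, ?_⟩
  · rw [lt_div_iff₀ hk']
    linarith
  · rw [div_lt_iff₀ hk']
    linarith

/-! ### Lifting along the `k`-fold covering of the circle -/

/-- The lifts `x ↦ (G (k x) + n) / k`, for `n : ℤ`, are the lifts to the line of the circle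
homeomorphisms that cover the one with lift `G` along `x ↦ k • x`. -/
def coverLift (k : ℕ) [NeZero k] (n : ℤ) (G : CircleDeg1Liftˣ) : CircleDeg1Liftˣ where
  val := ⟨⟨fun x => (G (k * x) + n) / k, fun x y hxy => by
      have : G (k * x) ≤ G (k * y) := (units_strictMono G).monotone (by gcongr)
      dsimp only
      gcongr⟩, fun x => by
      have hk : (k : ℝ) ≠ 0 := NeZero.ne _
      change (G (k * (x + 1)) + n) / k = (G (k * x) + n) / k + 1
      rw [mul_add, mul_one, map_add_nat]
      field_simp
      ring⟩
  inv := ⟨⟨fun x => (G⁻¹ : CircleDeg1Liftˣ) (k * x - n) / k, fun x y hxy => by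
      have : (G⁻¹ : CircleDeg1Liftˣ) (k * x - n) ≤ (G⁻¹ : CircleDeg1Liftˣ) (k * y - n) :=
        (units_strictMono G⁻¹).monotone (by gcongr)
      dsimp only
      gcongr⟩, fun x => by
      have hk : (k : ℝ) ≠ 0 := NeZero.ne _
      change (G⁻¹ : CircleDeg1Liftˣ) (k * (x + 1) - n) / k =
        (G⁻¹ : CircleDeg1Liftˣ) (k * x - n) / k + 1
      rw [mul_add, mul_one, add_sub_right_comm, map_add_nat]
      field_simp⟩
  val_inv := by
    ext x
    have hk : (k : ℝ) ≠ 0 := NeZero.ne _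
    change (G (k * ((G⁻¹ : CircleDeg1Liftˣ) (k * x - n) / k)) + n) / k = x
    rw [mul_div_cancel₀ _ hk, units_apply_inv_apply]
    field_simp
    ring
  inv_val := by
    ext x
    have hk : (k : ℝ) ≠ 0 := NeZero.ne _
    change (G⁻¹ : CircleDeg1Liftˣ) (k * ((G (k * x) + n) / k) - n) / k = x
    rw [mul_div_cancel₀ _ hk, add_sub_cancel_right, units_inv_apply_apply]
    field_simp

section CoverLift

variable {k : ℕ} [NeZero k]

theorem coverLift_apply (n : ℤ) (G : CircleDeg1Liftˣ) (x : ℝ) :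
    coverLift k n G x = (G (k * x) + n) / k := rfl

theorem mul_coverLift_apply (n : ℤ) (G : CircleDeg1Liftˣ) (x : ℝ) :
    k * coverLift k n G x = G (k * x) + n := by
  have hk : (k : ℝ) ≠ 0 := NeZero.ne _
  rw [coverLift_apply, mul_div_cancel₀ _ hk]

theorem units_ext {F G : CircleDeg1Liftˣ} (h : ∀ x, F x = G x) : F = G :=
  Units.ext (CircleDeg1Lift.ext h)

theorem coverLift_mul (n m : ℤ) (G H : CircleDeg1Liftˣ) :
    coverLift k n G * coverLift k m H = coverLift k (n + m) (G * H) := units_ext fun x => by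
  rw [units_mul_apply, coverLift_apply, mul_coverLift_apply, coverLift_apply, map_add_int,
    units_mul_apply]
  push_cast
  ring

theorem coverLift_pow (n : ℤ) (G : CircleDeg1Liftˣ) (r : ℕ) :
    coverLift k n G ^ r = coverLift k (r * n) (G ^ r) := by
  induction r with
  | zero =>
    refine units_ext fun x => ?_
    have hk : (k : ℝ) ≠ 0 := NeZero.ne _
    rw [coverLift_apply]
    simp [hk]
  | succ r ih =>
    rw [pow_succ, ih, coverLift_mul, pow_succ]
    congr 1
    push_cast
    ring

theorem coverLift_pow_apply {n m l : ℤ} {G : CircleDeg1Liftˣ} {r : ℕ}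
    (hG : ∀ y, (G ^ r : CircleDeg1Liftˣ) y = y + m) (hl : m + r * n = k * l) (x : ℝ) :
    (coverLift k n G ^ r : CircleDeg1Liftˣ) x = x + l := by
  have hk : (k : ℝ) ≠ 0 := NeZero.ne _
  have hl' : (m : ℝ) + r * n = k * l := by exact_mod_cast hl
  rw [coverLift_pow, coverLift_apply, hG]
  push_cast
  field_simp
  linear_combination hl'

theorem IsLift.nsmul_apply {f g : HomeoPlus} {G : CircleDeg1Liftˣ} {n : ℤ} (hf : IsLift f G)
    (hg : IsLift g (coverLift k n G)) (x : UnitAddCircle) : k • g.1 x = f.1 (k • x) := by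
  induction x using QuotientAddGroup.induction_on with
  | H x =>
    have e : k • (x : UnitAddCircle) = ((k * x : ℝ) : UnitAddCircle) := by
      rw [← AddCircle.coe_nsmul, nsmul_eq_mul]
    have h1 := hg x
    have h2 := hf (k * x)
    refine (congrArg (k • ·) h1).trans ?_
    refine Eq.trans ?_ (congrArg f.1 e.symm)
    rw [h2]
    change k • ((coverLift k n G x : ℝ) : UnitAddCircle) = _
    rw [← AddCircle.coe_nsmul, nsmul_eq_mul, mul_coverLift_apply, AddCircle.coe_add,
      coe_int_eq_zero, add_zero]

/-- A homeomorphism `g` covering `f` has a lift of the form `coverLift k n G`. -/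
theorem exists_isLift_coverLift {f g : HomeoPlus} {G : CircleDeg1Liftˣ} (hf : IsLift f G)
    (hg : ∀ x : UnitAddCircle, k • g.1 x = f.1 (k • x)) : ∃ n, IsLift g (coverLift k n G) := by
  obtain ⟨H, hH⟩ := g.2
  have h1 : ∀ x : ℝ, ∃ n : ℤ, k * H x = G (k * x) + n := by
    intro x
    rw [← coe_eq_coe, ← hf]
    have h2 := hg (x : UnitAddCircle)
    rw [hH] at h2
    simpa only [← AddCircle.coe_nsmul, nsmul_eq_mul] using h2
  -- the integer is a continuous function of the point, hence constant
  choose n hn using h1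
  have hc : Continuous fun x => ((n x : ℤ) : ℝ) := by
    have : (fun x => ((n x : ℤ) : ℝ)) = fun x => k * H x - G (k * x) := by
      funext x
      rw [hn x]
      ring
    rw [this]
    exact (continuous_const.mul (units_continuous H)).sub
      ((units_continuous G).comp (continuous_const.mul continuous_id))
  have hn' : Continuous n := Int.isClosedEmbedding_coe_real.isEmbedding.continuous_iff.2 hc
  refine ⟨n 0, ?_⟩
  have : coverLift k (n 0) G = H := units_ext fun x => by
    have hk : (k : ℝ) ≠ 0 := NeZero.ne _
    rw [coverLift_apply, PreconnectedSpace.constant inferInstance hn' (y := x), ← hn x,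
      mul_div_cancel_left₀ _ hk]
  rw [this]
  exact hH

/-- Lifts whose parameters are congruent modulo `k` define the same circle homeomorphism. -/
theorem IsLift.coverLift_add {f : HomeoPlus} {G : CircleDeg1Liftˣ} {n : ℤ}
    (hf : IsLift f (coverLift k n G)) (j : ℤ) : IsLift f (coverLift k (n + k * j) G) := by
  have : coverLift k (n + k * j) G =
      translate (Multiplicative.ofAdd (j : ℝ)) * coverLift k n G := units_ext fun x => by
    have hk : (k : ℝ) ≠ 0 := NeZero.ne _
    rw [units_mul_apply, translate_apply, coverLift_apply, coverLift_apply]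
    push_cast
    field_simp
    ring
  rw [this]
  exact hf.translate_mul j

/-- If `G ^ r` is the translation by `m`, a finite order homeomorphism covering the one with lift
`G` has a lift `coverLift k n G` with `k ∣ m + r n`. -/
theorem dvd_of_isLift_coverLift {g : HomeoPlus} {G : CircleDeg1Liftˣ} {r : ℕ} {n m : ℤ}
    (hg : IsLift g (coverLift k n G)) (hG : ∀ y, (G ^ r : CircleDeg1Liftˣ) y = y + m)
    (hr : g ^ r = 1) : (k : ℤ) ∣ m + r * n := by
  have h := hg.pow r
  rw [hr] at h
  obtain ⟨l, hl⟩ := h.exists_eq_add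
  refine ⟨l, ?_⟩
  have hk : (k : ℝ) ≠ 0 := NeZero.ne _
  have := hl 0
  rw [coverLift_pow, coverLift_apply, hG] at this
  push_cast at this
  field_simp at this
  have h2 : (m : ℝ) + r * n = k * l := by linarith
  exact_mod_cast h2

end CoverLift

/-- Being a `k`-fold lift can be checked on the two generators. -/
theorem isFoldLift_of_gens {k : ℕ} {ψ φ : Gam →* HomeoPlus}
    (hα : ∀ x : UnitAddCircle, k • (ψ α).1 x = (φ α).1 (k • x))
    (hβ : ∀ x : UnitAddCircle, k • (ψ β).1 x = (φ β).1 (k • x)) : IsFoldLift k ψ φ :=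
  mem_subgroup_of_gens
    { carrier := {γ | ∀ x : UnitAddCircle, k • (ψ γ).1 x = (φ γ).1 (k • x)}
      one_mem' := fun x => by
        rw [map_one, map_one]
        rfl
      mul_mem' := fun {γ δ} hγ hδ x => by
        rw [map_mul, map_mul]
        exact (hγ _).trans (congrArg _ (hδ x))
      inv_mem' := fun {γ} hγ x => by
        apply (φ γ).1.injective
        rw [← hγ, map_inv, map_inv]
        exact (congrArg _ ((ψ γ).1.apply_symm_apply x)).trans
          ((φ γ).1.apply_symm_apply _).symm } hα hβ

theorem hom_ext {ψ φ : Gam →* HomeoPlus} (hα : ψ α = φ α) (hβ : ψ β = φ β) : ψ = φ :=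
  PresentedGroup.ext fun i => by
    fin_cases i
    · exact hα
    · exact hβ

theorem exists_hom {a b : HomeoPlus} (ha : a ^ 2 = 1) (hb : b ^ 3 = 1) :
    ∃ ψ : Gam →* HomeoPlus, ψ α = a ∧ ψ β = b := by
  have h : ∀ r ∈ modularRels, FreeGroup.lift ![a, b] r = 1 := by
    rintro r (rfl | rfl)
    · simpa using ha
    · simpa using hb
  exact ⟨PresentedGroup.toGroup h, PresentedGroup.toGroup.of h, PresentedGroup.toGroup.of h⟩

theorem ofLift_pow_eq_one {F : CircleDeg1Liftˣ} {r : ℕ} {l : ℤ}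
    (h : ∀ y, (F ^ r : CircleDeg1Liftˣ) y = y + l) : ofLift F ^ r = 1 := by
  refine ((isLift_ofLift F).pow r).eq_of fun x => ?_
  rw [h, AddCircle.coe_add, coe_int_eq_zero, add_zero]
  rfl

theorem sq_apply (F : CircleDeg1Liftˣ) (y : ℝ) : (F ^ 2 : CircleDeg1Liftˣ) y = F (F y) := by
  rw [pow_two, units_mul_apply]

theorem cube_apply (F : CircleDeg1Liftˣ) (y : ℝ) :
    (F ^ 3 : CircleDeg1Liftˣ) y = F (F (F y)) := by
  simp only [pow_succ, pow_zero, one_mul, units_mul_apply]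

/-! ### Rigidity -/

/-- A pair of ping-pong partitions of the same type gives a semi-conjugacy into a `k`-fold lift of
the Fuchsian action, once the values of any equivariant monotone map are known to cover the fibre
over the cusp. -/
theorem semiConjugate_of_isPingPong {K : ℕ} (hK : 0 < K) {φ ψ : Gam →* HomeoPlus}
    {A B A' B' : CircleDeg1Liftˣ} {k a b m : ℤ} {p q p' q' : ℤ → ℝ}
    (hψ : IsFoldLift K ψ fuchsian) (lA : IsLift (φ α) A) (lB : IsLift (φ β) B)
    (lA' : IsLift (ψ α) A') (lB' : IsLift (ψ β) B') (hk : 0 < k)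
    (hA : ∀ y, A (A y) = y + 1) (hA' : ∀ y, A' (A' y) = y + 1)
    (hB : ∀ y, B (B (B y)) = y + m) (hB' : ∀ y, B' (B' (B' y)) = y + m)
    (h : IsPingPong A B k a b p q) (h' : IsPingPong A' B' k a b p' q')
    (hfib : ∀ F : CircleDeg1Lift, (∀ y, F (A y) = A' (F y)) → (∀ y, F (B y) = B' (F y)) →
      ∀ x : UnitAddCircle, K • x = 0 → ∃ y, ((F y : ℝ) : UnitAddCircle) = x) :
    SemiConjugate φ ψ := by
  obtain ⟨F, hF⟩ := exists_semiconj hk hA hA' hB hB' h h'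
  refine semiConjugate_of_lift lA lB lA' lB' (continuous_of_fibre_subset hK hψ F ?_ ?_) hF
  · intro γ y
    obtain ⟨w, rfl⟩ := PresentedGroup.mk_surjective modularRels γ
    refine ⟨freeAction A B w y, ?_⟩
    rw [hF, isLift_freeAction lA' lB']
  · refine hfib F (fun y => ?_) fun y => ?_
    · simpa using hF (FreeGroup.of 0) y
    · simpa using hF (FreeGroup.of 1) y

theorem exists_lift_α {φ : Gam →* HomeoPlus} (h : rot (φ α) = ((1 / 2 : ℝ) : UnitAddCircle)) :
    ∃ A, IsLift (φ α) A ∧ ∀ y, A (A y) = y + 1 := by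
  obtain ⟨A, hA, hA2⟩ := exists_lift_pow_eq (f := φ α) (m := 1) two_ne_zero
    (by rw [← map_pow, α_sq, map_one]) (by simpa using h)
  refine ⟨A, hA, fun y => ?_⟩
  rw [← sq_apply, hA2, Int.cast_one]

theorem exists_lift_β {φ : Gam →* HomeoPlus} (m : ℤ)
    (h : rot (φ β) = ((m / 3 : ℝ) : UnitAddCircle)) :
    ∃ B, IsLift (φ β) B ∧ ∀ y, B (B (B y)) = y + m := by
  obtain ⟨B, hB, hB3⟩ := exists_lift_pow_eq (f := φ β) (m := m) three_ne_zero
    (by rw [← map_pow, β_cube, map_one]) (by simpa using h)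
  refine ⟨B, hB, fun y => ?_⟩
  rw [← cube_apply, hB3]

theorem exists_translationNumber_eq {φ : Gam →* HomeoPlus} {A B : CircleDeg1Liftˣ}
    (lA : IsLift (φ α) A) (lB : IsLift (φ β) B) {r : ℝ}
    (h : rot (φ (α * β)) = (r : UnitAddCircle)) :
    ∃ N : ℤ, translationNumber ((A * B : CircleDeg1Liftˣ) : CircleDeg1Lift) = r + N := by
  rw [map_mul, rot_eq _ _ (lA.mul lB), coe_eq_coe] at h
  exact h

theorem half_sq (y : ℝ) : translate (Multiplicative.ofAdd (1 / 2 : ℝ))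
    (translate (Multiplicative.ofAdd (1 / 2 : ℝ)) y) = y + 1 := by
  simp only [translate_apply]
  ring

/-- The point where the lifts of `α` and `β` agree is mapped to the fixed point of `α⁻¹ β`, which
is the whole fibre of the trivial covering over the cusp. -/
theorem semiConjugate_fuchsian {φ : Gam →* HomeoPlus}
    (hα : rot (φ α) = ((1 / 2 : ℝ) : UnitAddCircle))
    (hβ : rot (φ β) = ((1 / 3 : ℝ) : UnitAddCircle))
    (hαβ : rot (φ (α * β)) = ((0 : ℝ) : UnitAddCircle)) : SemiConjugate φ fuchsian := by
  obtain ⟨A, lA, hA⟩ := exists_lift_α hα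
  obtain ⟨B, lB, hB⟩ := exists_lift_β 1 (by simpa using hβ)
  obtain ⟨N, hN⟩ := exists_translationNumber_eq lA lB hαβ
  rw [zero_add] at hN
  obtain ⟨x, hx⟩ := exists_map_eq_map hA hB hN
  obtain ⟨B', lB', hB0, hB'⟩ := exists_lift_fuchsian_β
  refine semiConjugate_of_isPingPong one_pos (fun γ x => by rw [one_smul, one_smul]) lA lB
    isLift_fuchsian_α lB' one_pos hA half_sq hB hB' (isPingPong_one hA hB hx)
    (isPingPong_one (x := 0) half_sq hB' (by rw [hB0, translate_apply, add_zero])) ?_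
  intro F hFA hFB z hz
  rw [one_smul] at hz
  refine ⟨x, hz ▸ eq_zero_of_fuchsian_eq ?_⟩
  rw [isLift_fuchsian_α, lB', ← hFA, ← hFB, hx]

section FiveFold

variable {B : CircleDeg1Liftˣ}

/-- A point fixed by `(α β)⁵` up to the expected translation in the five-fold lift lies over the
cusp. -/
theorem coe_five_mul_eq_zero (lB : IsLift (fuchsian β) B) {y : ℝ}
    (hy : ((coverLift 5 2 (translate (Multiplicative.ofAdd (1 / 2 : ℝ))) * coverLift 5 3 B) ^ 5 :
      CircleDeg1Liftˣ) y = y + 6) : ((5 * y : ℝ) : UnitAddCircle) = 0 := by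
  rw [coverLift_mul, coverLift_pow, coverLift_apply] at hy
  set C := translate (Multiplicative.ofAdd (1 / 2 : ℝ)) * B with hC
  have h1 : (C ^ 5 : CircleDeg1Liftˣ) (5 * y) = 5 * y + (5 : ℕ) * (1 : ℤ) := by
    push_cast at hy ⊢
    field_simp at hy
    linarith
  rw [Units.val_pow_eq_pow_val, coe_pow, iterate_pos_eq_iff _ (by norm_num)] at h1
  apply eq_zero_of_fuchsian_eq
  rw [isLift_fuchsian_α, lB]
  congr 1
  rw [hC, units_mul_apply] at h1
  apply (units_strictMono (translate (Multiplicative.ofAdd (1 / 2 : ℝ)))).injective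
  rw [h1, half_sq, Int.cast_one]

theorem five_mul_apply_int (hB0 : B 0 = 1 / 2) {y : ℝ} {M : ℤ} (hy : 5 * y = M) :
    5 * coverLift 5 2 (translate (Multiplicative.ofAdd (1 / 2 : ℝ))) (coverLift 5 3 B y) =
      M + 6 := by
  rw [← units_mul_apply, coverLift_mul, show (2 + 3 : ℤ) = 5 from rfl]
  have h := mul_coverLift_apply (k := 5) 5 (translate (Multiplicative.ofAdd (1 / 2 : ℝ)) * B) y
  rw [units_mul_apply] at h
  have h2 := map_int_of_map_zero (B : CircleDeg1Lift) M
  push_cast at h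
  rw [h, hy, h2, hB0, translate_apply]
  ring

theorem five_cover_pow_zero (hB0 : B 0 = 1 / 2) :
    ((coverLift 5 2 (translate (Multiplicative.ofAdd (1 / 2 : ℝ))) * coverLift 5 3 B) ^ 5 :
      CircleDeg1Liftˣ) 0 = 0 + 6 := by
  have key : ∀ n : ℕ, 5 * ((coverLift 5 2 (translate (Multiplicative.ofAdd (1 / 2 : ℝ))) *
      coverLift 5 3 B) ^ n : CircleDeg1Liftˣ) 0 = ((6 * n : ℤ) : ℝ) := by
    intro n
    induction n with
    | zero => simp
    | succ n ih =>
      rw [pow_succ', units_mul_apply, units_mul_apply, five_mul_apply_int hB0 ih]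
      push_cast
      ring
  have := key 5
  rw [show ((6 * (5 : ℕ) : ℤ) : ℝ) = 30 by norm_num] at this
  linarith

/-- The points `p j` of the five-orbit are mapped onto the fibre of the covering over the cusp. -/
theorem semiConjugate_five {φ ψ : Gam →* HomeoPlus} (hB0 : B 0 = 1 / 2)
    (lB : IsLift (fuchsian β) B) (hB : ∀ y, B (B (B y)) = y + (1 : ℤ))
    (hψ : IsFoldLift 5 ψ fuchsian)
    (lA' : IsLift (ψ α) (coverLift 5 2 (translate (Multiplicative.ofAdd (1 / 2 : ℝ)))))
    (lB' : IsLift (ψ β) (coverLift 5 3 B))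
    (hα : rot (φ α) = ((1 / 2 : ℝ) : UnitAddCircle))
    (hβ : rot (φ β) = ((2 / 3 : ℝ) : UnitAddCircle))
    (hαβ : rot (φ (α * β)) = ((1 / 5 : ℝ) : UnitAddCircle)) : SemiConjugate φ ψ := by
  obtain ⟨A₁, lA₁, hA₁⟩ := exists_lift_α hα
  obtain ⟨B₁, lB₁, hB₁⟩ := exists_lift_β 2 (by simpa using hβ)
  obtain ⟨N, hN⟩ := exists_translationNumber_eq lA₁ lB₁ hαβ
  obtain ⟨x, hx⟩ := exists_pow_five_eq hA₁ hB₁ hN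
  obtain ⟨p, q, hp0, hpq⟩ := exists_isFiveOrbit hA₁ hB₁ hx
  set A' := coverLift 5 2 (translate (Multiplicative.ofAdd (1 / 2 : ℝ))) with hA'def
  set B' := coverLift 5 3 B with hB'def
  have hA' : ∀ y, A' (A' y) = y + 1 := fun y => by
    rw [← sq_apply, hA'def, coverLift_pow_apply (m := 1) (l := 1) _ (by norm_num), Int.cast_one]
    intro y
    rw [sq_apply, half_sq, Int.cast_one]
  have hB' : ∀ y, B' (B' (B' y)) = y + (2 : ℤ) := fun y => by
    rw [← cube_apply, hB'def, coverLift_pow_apply (m := 1) (l := 2) _ (by norm_num)]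
    intro y
    rw [cube_apply, hB]
  obtain ⟨p', q', -, hpq'⟩ := exists_isFiveOrbit hA' hB' (five_cover_pow_zero hB0)
  refine semiConjugate_of_isPingPong (by norm_num) hψ lA₁ lB₁ lA' lB' (by norm_num) hA₁ hA' hB₁ hB'
    hpq.isPingPong hpq'.isPingPong ?_
  intro F hFA hFB z hz
  have hFC : ∀ y, F ((A₁ * B₁ : CircleDeg1Liftˣ) y) = (A' * B' : CircleDeg1Liftˣ) (F y) :=
    fun y => by rw [units_mul_apply, units_mul_apply, hFA, hFB]
  have hpow : ((A' * B') ^ 5 : CircleDeg1Liftˣ) (F x) = F x + 6 := by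
    have h1 := map_add_nat F x 6
    push_cast at h1
    rw [← h1, ← hx]
    simp only [Units.val_pow_eq_pow_val, coe_pow]
    exact ((Function.Semiconj.iterate_right hFC 5) x).symm
  have hzero := coe_five_mul_eq_zero lB hpow
  obtain ⟨M, hM⟩ := (coe_eq_coe (5 * F x) 0).1 hzero
  rw [zero_add] at hM
  -- `F` maps the points `p j` to consecutive points of the fibre
  have hj : ∀ j : ℕ, 5 * F (p j) = ((M + j : ℤ) : ℝ) := by
    intro j
    induction j with
    | zero => simpa [hp0] using hM
    | succ j ih =>
      have h1 := five_mul_apply_int hB0 ih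
      rw [← hB'def, ← hA'def, ← hFB, ← hFA, hpq.B_p, hpq.A_q,
        show (j : ℤ) + 6 = (j + 1 : ℤ) + 5 by ring, hpq.p_add, map_add_one] at h1
      push_cast at h1 ⊢
      linarith
  induction z using QuotientAddGroup.induction_on with
  | H z =>
    have hz1 : ((5 * z : ℝ) : UnitAddCircle) = ((0 : ℝ) : UnitAddCircle) := by
      refine Eq.trans ?_ hz
      rw [show (5 * z : ℝ) = 5 • z by simp, AddCircle.coe_nsmul]
    obtain ⟨L, hL⟩ := (coe_eq_coe _ _).1 hz1
    have h0 : 0 ≤ (L - M) % 5 := Int.emod_nonneg _ (by norm_num)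
    obtain ⟨j, hj'⟩ := Int.eq_ofNat_of_zero_le h0
    have hdiv := Int.emod_add_mul_ediv (L - M) 5
    rw [hj'] at hdiv
    refine ⟨p j, (coe_eq_coe _ _).2 ⟨-((L - M) / 5), ?_⟩⟩
    have h2 : ((j : ℤ) : ℝ) + 5 * ((L - M) / 5 : ℤ) = L - M := by exact_mod_cast hdiv
    have h3 := hj j
    push_cast at h2 h3 ⊢
    linarith

/-- The lifts `coverLift 5 n G` of the two generators satisfy the relations of the modular group
on the circle exactly when `1 + 2 n`, respectively `1 + 3 n`, is divisible by `5`, which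
determines them up to integer translations. -/
theorem exists_five_fold_lift (lB : IsLift (fuchsian β) B)
    (hB : ∀ y, B (B (B y)) = y + (1 : ℤ)) : ∃ ψ : Gam →* HomeoPlus,
      IsLift (ψ α) (coverLift 5 2 (translate (Multiplicative.ofAdd (1 / 2 : ℝ)))) ∧
      IsLift (ψ β) (coverLift 5 3 B) ∧ ∀ ψ', IsFoldLift 5 ψ' fuchsian ↔ ψ' = ψ := by
  have hA2 : ∀ y, (translate (Multiplicative.ofAdd (1 / 2 : ℝ)) ^ 2 : CircleDeg1Liftˣ) y =
      y + (1 : ℤ) := fun y => by rw [sq_apply, half_sq, Int.cast_one]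
  have hB3 : ∀ y, (B ^ 3 : CircleDeg1Liftˣ) y = y + (1 : ℤ) := fun y => by rw [cube_apply, hB]
  obtain ⟨ψ, hα, hβ⟩ := exists_hom
    (ofLift_pow_eq_one (coverLift_pow_apply (k := 5) (n := 2) (l := 1) hA2 (by norm_num)))
    (ofLift_pow_eq_one (coverLift_pow_apply (k := 5) (n := 3) (l := 2) hB3 (by norm_num)))
  have lα := isLift_ofLift (coverLift 5 2 (translate (Multiplicative.ofAdd (1 / 2 : ℝ))))
  have lβ := isLift_ofLift (coverLift 5 3 B)
  rw [← hα] at lα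
  rw [← hβ] at lβ
  refine ⟨ψ, lα, lβ, fun ψ' => ⟨fun h => hom_ext ?_ ?_, ?_⟩⟩
  · obtain ⟨n, hn⟩ := exists_isLift_coverLift isLift_fuchsian_α (h α)
    obtain ⟨l, hl⟩ := dvd_of_isLift_coverLift hn hA2 (by rw [← map_pow, α_sq, map_one])
    push_cast at hl
    refine hn.eq_of ?_
    rw [show n = 2 + (5 : ℕ) * ((n - 2) / 5) by push_cast; omega]
    exact lα.coverLift_add _
  · obtain ⟨n, hn⟩ := exists_isLift_coverLift lB (h β)
    obtain ⟨l, hl⟩ := dvd_of_isLift_coverLift hn hB3 (by rw [← map_pow, β_cube, map_one])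
    push_cast at hl
    refine hn.eq_of ?_
    rw [show n = 3 + (5 : ℕ) * ((n - 3) / 5) by push_cast; omega]
    exact lβ.coverLift_add _
  · rintro rfl
    exact isFoldLift_of_gens (isLift_fuchsian_α.nsmul_apply lα) (lB.nsmul_apply lβ)

end FiveFold

end ModularCircle

end

theorem theorem1p1 :
    (∀ φ : ModularCircle.Gam →* ModularCircle.HomeoPlus,
      ModularCircle.rot (φ ModularCircle.α) = ((1 / 2 : ℝ) : UnitAddCircle) →
      ModularCircle.rot (φ ModularCircle.β) = ((1 / 3 : ℝ) : UnitAddCircle) →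
      ModularCircle.rot (φ (ModularCircle.α * ModularCircle.β)) = ((0 : ℝ) : UnitAddCircle) →
      ModularCircle.SameSemiConjugacyClass φ ModularCircle.fuchsian) ∧
    ∃ ψ : ModularCircle.Gam →* ModularCircle.HomeoPlus,
      (∀ ψ' : ModularCircle.Gam →* ModularCircle.HomeoPlus,
        ModularCircle.IsFoldLift 5 ψ' ModularCircle.fuchsian ↔ ψ' = ψ) ∧
      ∀ φ : ModularCircle.Gam →* ModularCircle.HomeoPlus,
        ModularCircle.rot (φ ModularCircle.α) = ((1 / 2 : ℝ) : UnitAddCircle) →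
        ModularCircle.rot (φ ModularCircle.β) = ((2 / 3 : ℝ) : UnitAddCircle) →
        ModularCircle.rot (φ (ModularCircle.α * ModularCircle.β)) =
          ((1 / 5 : ℝ) : UnitAddCircle) →
        ModularCircle.SameSemiConjugacyClass φ ψ := by
  refine ⟨fun φ hα hβ hαβ => .rel _ _ (ModularCircle.semiConjugate_fuchsian hα hβ hαβ), ?_⟩
  obtain ⟨B, lB, hB0, hB⟩ := ModularCircle.exists_lift_fuchsian_β
  obtain ⟨ψ, lα, lβ, hψ⟩ := ModularCircle.exists_five_fold_lift lB hB
  exact ⟨ψ, hψ, fun φ hα hβ hαβ => .rel _ _ (ModularCircle.semiConjugate_five hB0 lB hB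
    ((hψ ψ).2 rfl) lα lβ hα hβ hαβ)⟩
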